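/- Throughout, $\mu$ denotes a probability measure on $\mathbb{R}$. Sequences $(\beta_n)_{n\ge0}$, $(\gamma_n)_{n\ge0}$ of real numbers are called Jacobi parameters of $\mu$ if all moments of $\mu$ are finite and the monic polynomials defined by $P_{-1}=0$, $P_0=1$, $xP_n=P_{n+1}+\beta_nP_n+\gamma_{n-1}P_{n-1}$ are pairwise orthogonal in $L^2(\mu)$. (Then the terms up to and including the first vanishing $\gamma_n$ are uniquely determined by $\mu$, and those $\gamma_n$ are nonnegative; the terms after the first vanishing $\gamma_n$, which is present exactly when $\mu$ has finite support, are arbitrary and are disregarded.) Call $(\beta_0,\gamma_0,b,c)\in\mathbb{R}^4$ admissible if $\gamma_0\ge 0$ and either $c\ge0$ or $c=-\gamma_0/N$ for some integer $N\ge1$. The measure $\mu$ is a Meixner distribution with admissible parameters $(\beta_0,\gamma_0,b,c)$ if $\beta_n=nb+\beta_0$, $\gamma_n=(n+1)(nc+\gamma_0)$, $n \ge 0$, are Jacobi parameters of $\mu$. Let $T\subseteq[0,\infty)$ be closed under addition with $1\in T$ (for example $T=\{1,2,3,\dots\}$, $T=\{n/N: n\ge 1\}$ or $T=[0,\infty)$).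 A family $(\mu_t)_{t\in T}$ of probability measures on $\mathbb{R}$ is a convolution semigroup if $\mu_{s+t}=\mu_s*\mu_t$ for all $s,t\in T$. Its Jacobi parameters are polynomial in $t$ if there are real polynomials $B_n,G_n$ ($n\ge0$) such that, for every $t\in T$, $\beta_n=B_n(t)$, $\gamma_n=G_n(t)$ are Jacobi parameters of $\mu_t$. **Corollary.** 1. A family $(\mu_t)_{t\in T}$ of probability measures on $\mathbb{R}$ is a convolution semigroup whose Jacobi parameters are polynomial in $t$ if and only if there are admissible parameters $(\beta_0,\gamma_0,b,c)$, with $c\ge0$ if $T=[0,\infty)$, such that for all $t\in T$ the Jacobi parameters of $\mu_t$ are $$\beta_n(t)=nb+\beta_0t,\qquad \gamma_n(t)=(n+1)(nc+\gamma_0t)\qquad(n\ge0).\tag{$*$}$$ 2. Suppose that $T\subseteq\mathbb{Q}$ (in particular, $T$ may be the set of positive integers). If $(\mu_t)_{t\in T}$ is a convolution semigroup and $\mu_1$ is a Meixner distribution with admissible parameters $(\beta_0,\gamma_0,b,c)$, then $(*)$ holds for all $t\in T$. 3. If $(\mu_t)_{t\ge0}$ is a weakly continuous convolution semigroup and $\mu_1$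 is a Meixner distribution with admissible parameters $(\beta_0,\gamma_0,b,c)$, then $c\ge0$ and $(*)$ holds for all $t\ge0$. -/

import Mathlib

open MeasureTheory

/-- The monic polynomials defined by the three-term recurrence
`P₀ = 1`, `x Pₙ = Pₙ₊₁ + βₙ Pₙ + γₙ₋₁ Pₙ₋₁` (with `P₋₁ = 0`). -/
noncomputable def jacobiPolynomial (β γ : ℕ → ℝ) : ℕ → Polynomial ℝ
  | 0 => 1
  | 1 => Polynomial.X - Polynomial.C (β 0)
  | n + 2 => (Polynomial.X - Polynomial.C (β (n + 1))) * jacobiPolynomial β γ (n + 1)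
      - Polynomial.C (γ n) * jacobiPolynomial β γ n

/-- `(β, γ)` is a sequence of Jacobi parameters of `μ`: all moments of `μ` are finite and the monic
polynomials given by the three-term recurrence are pairwise orthogonal with respect to `μ`.

For a probability measure, orthogonality gives `∫ Pₙ₊₁² dμ = γₙ ∫ Pₙ² dμ`; hence the parameters up to
and including the first vanishing `γₙ` are determined by `μ` and these `γₙ` are nonnegative. If
`γ_{N-1} = 0` is the first one that vanishes (`μ` has exactly `N` atoms), then `P_m = 0` holds
`μ`-almost everywhere for all `m ≥ N`, so the later parameters are not constrained at all:
an infinite sequence may be written, with the terms after the first vanishing `γₙ` disregarded. -/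
def HasJacobiParameters (μ : Measure ℝ) (β γ : ℕ → ℝ) : Prop :=
  (∀ m : ℕ, Integrable (fun x : ℝ => x ^ m) μ) ∧
  ∀ m n : ℕ, m ≠ n →
    ∫ x, (jacobiPolynomial β γ m).eval x * (jacobiPolynomial β γ n).eval x ∂μ = 0

/-- The restriction on the Meixner parameters: `γ₀ ≥ 0`, and `c ≥ 0` or `c = -γ₀ / N` for a positive
integer `N`. -/
def MeixnerAdmissible (γ₀ c : ℝ) : Prop :=
  0 ≤ γ₀ ∧ (0 ≤ c ∨ ∃ N : ℕ, 1 ≤ N ∧ c = -γ₀ / (N : ℝ))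

/-- `μ` is the Meixner distribution with parameters `β₀, γ₀, b, c`, that is, its Jacobi parameters
are `βₙ = n b + β₀`, `γₙ = (n + 1) (n c + γ₀)`. -/
def IsMeixner (μ : Measure ℝ) (β₀ γ₀ b c : ℝ) : Prop :=
  MeixnerAdmissible γ₀ c ∧
  HasJacobiParameters μ (fun n => (n : ℝ) * b + β₀) (fun n => ((n : ℝ) + 1) * ((n : ℝ) * c + γ₀))

/-- Sets of times: additive semigroups in `[0, ∞)` containing `1`, such as the positive integers,
`{n / N : n ≥ 1}` or `[0, ∞)`. -/
structure IsTimeSet (T : Set ℝ) : Prop where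
  nonneg : ∀ t ∈ T, 0 ≤ t
  one_mem : (1 : ℝ) ∈ T
  add_mem : ∀ s ∈ T, ∀ t ∈ T, s + t ∈ T

/-- `(μ_t)`, `t ∈ T`, is a convolution semigroup: `μ_{s+t} = μ_s ∗ μ_t`. -/
def IsConvolutionSemigroup (T : Set ℝ) (μ : ℝ → ProbabilityMeasure ℝ) : Prop :=
  ∀ s ∈ T, ∀ t ∈ T,
    (μ (s + t) : Measure ℝ) = Measure.conv (μ s : Measure ℝ) (μ t : Measure ℝ)

/-- The Jacobi parameters of `μ_t`, `t ∈ T`, are polynomials in `t`. -/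
def HasPolynomialJacobiParameters (T : Set ℝ) (μ : ℝ → ProbabilityMeasure ℝ) : Prop :=
  ∃ B G : ℕ → Polynomial ℝ, ∀ t ∈ T,
    HasJacobiParameters (μ t) (fun n => (B n).eval t) (fun n => (G n).eval t)

/-- For all `t ∈ T` the Jacobi parameters of `μ_t` are
`βₙ(t) = n b + β₀ t`, `γₙ(t) = (n + 1) (n c + γ₀ t)`. -/
def HasMeixnerJacobiParameters (T : Set ℝ) (μ : ℝ → ProbabilityMeasure ℝ) (β₀ γ₀ b c : ℝ) : Prop :=
  ∀ t ∈ T, HasJacobiParameters (μ t) (fun n => (n : ℝ) * b + β₀ * t)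
    (fun n => ((n : ℝ) + 1) * ((n : ℝ) * c + γ₀ * t))

/-! Measures are replaced by linear functionals on polynomials. The tridiagonal matrix J with the
given parameters yields the functional p ↦ (p(J)e₀)₀, and a probability measure has these Jacobi
parameters exactly when its moments are finite and given by this functional
(`hasJacobiParameters_iff`). Convolution becomes multiplication of exponential moment series.

Meixner parameters give semigroups: the generating function F = ∑ Pₙ zⁿ/n! solves (1 + bz + cz²)F' =
(x − β − γz)F. The factor on the right is additive in (x, β, γ), so a product of two solutions
solves the equation with summed data. The resulting binomial formula (`meixner_recurrence_add`)
shows that the functionals convolve (`functionalConv_meixnerFunctional`). Their moments are at most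
Cⁿ(n+1)!, hence determine the measure (`HasMoments.measure_eq`).

Conversely, fit β₀, γ₀, b, c to the parameters of index 0 and 1 at time 1, and suppose agreement
below index n. The first moment that can deviate does so by ∏_{k<n} γₖ(t) times the deviation of the
n-th parameter. A first deviation of multiplicative series is additive over integer times, so this
polynomial in t is a multiple of t. If γ₀ ≠ 0, the product alone has degree n: for n ≥ 2 the
deviation must vanish, and for n < 2 the fit at time 1 kills it (`jacobi_eq_meixner_step`). If γ₀ =
0, only index 0 matters.

The sign conditions come from ∏_{k<n} γₖ = ∫ Pₙ² dμ ≥ 0. For rational times, a power series with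
constant term 1 is determined by any positive power of it, so time 1 fixes all moments. Real times
follow by weak continuity, since the Meixner moments are continuous in t. -/

/-! ### Jacobi matrices and their moment functionals -/

/-- The Jacobi operator: the tridiagonal matrix with diagonal `β`, superdiagonal `γ` and
subdiagonal `1`, acting on sequences. -/
noncomputable def jacobiOperator (β γ : ℕ → ℝ) : Module.End ℝ (ℕ → ℝ) where
  toFun v k := (if k = 0 then 0 else v (k - 1)) + β k * v k + γ k * v (k + 1)
  map_add' v w := by
    ext k
    by_cases hk : k = 0 <;> simp [hk] <;> ring
  map_smul' a v := by
    ext k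
    by_cases hk : k = 0 <;> simp [hk] <;> ring

theorem jacobiOperator_apply_zero (β γ : ℕ → ℝ) (v : ℕ → ℝ) :
    jacobiOperator β γ v 0 = β 0 * v 0 + γ 0 * v 1 := by
  simp [jacobiOperator]

theorem jacobiOperator_apply_succ (β γ : ℕ → ℝ) (v : ℕ → ℝ) (k : ℕ) :
    jacobiOperator β γ v (k + 1) = v k + β (k + 1) * v (k + 1) + γ (k + 1) * v (k + 2) := by
  simp [jacobiOperator]

theorem jacobiOperator_single_zero (β γ : ℕ → ℝ) :
    jacobiOperator β γ (Pi.single 0 1) = Pi.single 1 1 + β 0 • Pi.single 0 1 := by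
  ext k
  rcases k with _ | _ | k
  · simp [jacobiOperator_apply_zero]
  · simp [jacobiOperator_apply_succ]
  · simp [jacobiOperator_apply_succ]

theorem jacobiOperator_single_succ (β γ : ℕ → ℝ) (n : ℕ) :
    jacobiOperator β γ (Pi.single (n + 1) 1) =
      Pi.single (n + 2) 1 + β (n + 1) • Pi.single (n + 1) 1 + γ n • Pi.single n 1 := by
  ext k
  rcases k with _ | k
  · by_cases h : n = 0
    · subst h
      simp [jacobiOperator_apply_zero]
    · simp [jacobiOperator_apply_zero, h, eq_comm]
  · simp only [jacobiOperator_apply_succ, Pi.add_apply, Pi.smul_apply, Pi.single_apply,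
      smul_eq_mul]
    have e1 : k = n + 1 ↔ k + 1 = n + 2 := by omega
    have e2 : k + 2 = n + 1 ↔ k + 1 = n := by omega
    simp only [e1, e2]
    by_cases h1 : k + 1 = n + 1 <;> by_cases h2 : k + 1 = n <;> simp_all

/-- The linear functional on polynomials whose monic orthogonal polynomials have the Jacobi
parameters `β`, `γ`. -/
noncomputable def jacobiFunctional (β γ : ℕ → ℝ) : Polynomial ℝ →ₗ[ℝ] ℝ :=
  (LinearMap.proj 0 : (ℕ → ℝ) →ₗ[ℝ] ℝ) ∘ₗ
    (LinearMap.applyₗ (Pi.single 0 1 : ℕ → ℝ) : Module.End ℝ (ℕ → ℝ) →ₗ[ℝ] (ℕ → ℝ)) ∘ₗ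
    (Polynomial.aeval (jacobiOperator β γ)).toLinearMap

theorem jacobiFunctional_apply (β γ : ℕ → ℝ) (p : Polynomial ℝ) :
    jacobiFunctional β γ p =
      Polynomial.aeval (jacobiOperator β γ) p (Pi.single 0 1 : ℕ → ℝ) 0 := rfl

theorem jacobiFunctional_one (β γ : ℕ → ℝ) : jacobiFunctional β γ 1 = 1 := by
  simp [jacobiFunctional_apply]

/-- Column n of the matrix is the three-term recurrence for x Pₙ, so eₙ plays the role of Pₙ and the
functional reads off the coefficient of P₀. -/
theorem aeval_jacobiPolynomial_single (β γ : ℕ → ℝ) (n : ℕ) :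
    Polynomial.aeval (jacobiOperator β γ) (jacobiPolynomial β γ n) (Pi.single 0 1 : ℕ → ℝ) =
      Pi.single n 1 := by
  induction n using Nat.strong_induction_on with
  | _ n ih =>
    rcases n with _ | _ | n
    · simp [jacobiPolynomial]
    · simp [jacobiPolynomial, jacobiOperator_single_zero, Module.algebraMap_end_apply]
    · have h1 := ih (n + 1) (by omega)
      have h0 := ih n (by omega)
      simp [jacobiPolynomial, h1, h0, jacobiOperator_single_succ, Module.algebraMap_end_apply]
      abel

/-- The dual of the column statement: row 0 of Pₙ(J) has one nonzero entry at most. With v = p(J)e₀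
it evaluates the functional at Pₙ p, which yields all the orthogonality relations. -/
theorem aeval_jacobiPolynomial_apply_zero (β γ : ℕ → ℝ) (n : ℕ) (v : ℕ → ℝ) :
    Polynomial.aeval (jacobiOperator β γ) (jacobiPolynomial β γ n) v 0 =
      (∏ k ∈ Finset.range n, γ k) * v n := by
  induction n using Nat.strong_induction_on generalizing v with
  | _ n ih =>
    rcases n with _ | _ | n
    · simp [jacobiPolynomial]
    · simp [jacobiPolynomial, jacobiOperator_apply_zero, Module.algebraMap_end_apply]
    · have h1 := ih (n + 1) (by omega)
      have h0 := ih n (by omega)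
      -- The linear factor must act first, so that the induction hypothesis applies to the vector (J
      -- − β)v.
      rw [jacobiPolynomial, mul_comm]
      simp only [map_sub, map_mul, Polynomial.aeval_X, Polynomial.aeval_C, LinearMap.sub_apply,
        Module.End.mul_apply, Pi.sub_apply, h1, h0, Module.algebraMap_end_apply,
        jacobiOperator_apply_succ, Pi.smul_apply, smul_eq_mul, Finset.prod_range_succ]
      ring

theorem jacobiFunctional_mul_apply (β γ : ℕ → ℝ) (n : ℕ) (p : Polynomial ℝ) :
    jacobiFunctional β γ (jacobiPolynomial β γ n * p) = (∏ k ∈ Finset.range n, γ k) *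
      Polynomial.aeval (jacobiOperator β γ) p (Pi.single 0 1 : ℕ → ℝ) n := by
  rw [jacobiFunctional_apply, map_mul, Module.End.mul_apply, aeval_jacobiPolynomial_apply_zero]

theorem jacobiFunctional_jacobiPolynomial_mul (β γ : ℕ → ℝ) (m n : ℕ) :
    jacobiFunctional β γ (jacobiPolynomial β γ m * jacobiPolynomial β γ n) =
      if m = n then ∏ k ∈ Finset.range m, γ k else 0 := by
  rw [jacobiFunctional_mul_apply, aeval_jacobiPolynomial_single, Pi.single_apply]
  split_ifs <;> simp

theorem jacobiFunctional_mul_X_mul (β γ : ℕ → ℝ) (n : ℕ) :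
    jacobiFunctional β γ
      (jacobiPolynomial β γ n * (Polynomial.X * jacobiPolynomial β γ n)) =
      (∏ k ∈ Finset.range n, γ k) * β n := by
  rw [jacobiFunctional_mul_apply, map_mul, Module.End.mul_apply, aeval_jacobiPolynomial_single,
    Polynomial.aeval_X]
  rcases n with _ | n
  · simp [jacobiOperator_apply_zero]
  · simp [jacobiOperator_apply_succ]

theorem jacobiPolynomial_monic_natDegree (β γ : ℕ → ℝ) (n : ℕ) :
    (jacobiPolynomial β γ n).Monic ∧ (jacobiPolynomial β γ n).natDegree = n := by
  induction n using Nat.strong_induction_on with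
  | _ n ih =>
    rcases n with _ | _ | n
    · simp [jacobiPolynomial]
    · simp [jacobiPolynomial, Polynomial.monic_X_sub_C]
    · obtain ⟨h1, h2⟩ := ih (n + 1) (by omega)
      obtain ⟨-, h4⟩ := ih n (by omega)
      have hm := (Polynomial.monic_X_sub_C (β (n + 1))).mul h1
      have hd : ((Polynomial.X - Polynomial.C (β (n + 1))) *
          jacobiPolynomial β γ (n + 1)).natDegree = n + 2 := by
        rw [(Polynomial.monic_X_sub_C _).natDegree_mul h1, h2, Polynomial.natDegree_X_sub_C]
        omega
      have hlt : (Polynomial.C (γ n) * jacobiPolynomial β γ n).degree <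
          ((Polynomial.X - Polynomial.C (β (n + 1))) * jacobiPolynomial β γ (n + 1)).degree := by
        rw [Polynomial.degree_eq_natDegree hm.ne_zero, hd]
        refine lt_of_le_of_lt (Polynomial.degree_le_natDegree) ?_
        have := Polynomial.natDegree_C_mul_le (γ n) (jacobiPolynomial β γ n)
        exact_mod_cast (by omega : (Polynomial.C (γ n) * jacobiPolynomial β γ n).natDegree < n + 2)
      refine ⟨hm.sub_of_left hlt, ?_⟩
      rw [jacobiPolynomial, Polynomial.natDegree_sub_eq_left_of_natDegree_lt, hd]
      rw [hd]
      have := Polynomial.natDegree_C_mul_le (γ n) (jacobiPolynomial β γ n)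
      omega

theorem jacobiPolynomial_monic (β γ : ℕ → ℝ) (n : ℕ) : (jacobiPolynomial β γ n).Monic :=
  (jacobiPolynomial_monic_natDegree β γ n).1

theorem natDegree_jacobiPolynomial (β γ : ℕ → ℝ) (n : ℕ) :
    (jacobiPolynomial β γ n).natDegree = n :=
  (jacobiPolynomial_monic_natDegree β γ n).2

/-- The polynomials `jacobiPolynomial β γ n` as a sequence of polynomials of degree `n`. -/
noncomputable def jacobiSequence (β γ : ℕ → ℝ) : Polynomial.Sequence ℝ where
  elems' := jacobiPolynomial β γ
  degree_eq' n := by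
    rw [Polynomial.degree_eq_natDegree (jacobiPolynomial_monic β γ n).ne_zero,
      natDegree_jacobiPolynomial]

theorem span_range_jacobiPolynomial (β γ : ℕ → ℝ) :
    Submodule.span ℝ (Set.range (jacobiPolynomial β γ)) = ⊤ :=
  (jacobiSequence β γ).span fun i => by
    have h : (jacobiPolynomial β γ i).leadingCoeff = 1 := jacobiPolynomial_monic β γ i
    change IsUnit (jacobiPolynomial β γ i).leadingCoeff
    simp [h]

theorem eq_jacobiFunctional {β γ : ℕ → ℝ} {A : Polynomial ℝ →ₗ[ℝ] ℝ} (h0 : A 1 = 1)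
    (h : ∀ n, A (jacobiPolynomial β γ (n + 1)) = 0) : A = jacobiFunctional β γ := by
  refine LinearMap.ext_on (span_range_jacobiPolynomial β γ) ?_
  rintro _ ⟨n, rfl⟩
  rw [jacobiFunctional_apply, aeval_jacobiPolynomial_single]
  rcases n with _ | n
  · simp [jacobiPolynomial, h0]
  · simp [h]

/-! ### Triangular dependence of the moments on the parameters -/

theorem jacobiPolynomial_congr {β γ β' γ' : ℕ → ℝ} (n : ℕ) (hβ : ∀ k < n, β k = β' k)
    (hγ : ∀ k, k + 1 < n → γ k = γ' k) : jacobiPolynomial β γ n = jacobiPolynomial β' γ' n := by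
  induction n using Nat.strong_induction_on with
  | _ n ih =>
    rcases n with _ | _ | n
    · simp [jacobiPolynomial]
    · simp [jacobiPolynomial, hβ 0 (by omega)]
    · rw [jacobiPolynomial, jacobiPolynomial, hβ (n + 1) (by omega), hγ n (by omega),
        ih (n + 1) (by omega) (fun k hk => hβ k (by omega)) (fun k hk => hγ k (by omega)),
        ih n (by omega) (fun k hk => hβ k (by omega)) (fun k hk => hγ k (by omega))]

theorem sub_apply_X_pow_eq {A A' : Polynomial ℝ →ₗ[ℝ] ℝ} {N : ℕ}
    (h : ∀ k < N, A (Polynomial.X ^ k) = A' (Polynomial.X ^ k)) {q : Polynomial ℝ} (hq : q.Monic)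
    (hd : q.natDegree = N) :
    A (Polynomial.X ^ N) - A' (Polynomial.X ^ N) = A q - A' q := by
  rw [hq.as_sum, hd]
  simp only [map_add, map_sum, Polynomial.C_mul']
  have : ∑ i ∈ Finset.range N, A (q.coeff i • Polynomial.X ^ i) =
      ∑ i ∈ Finset.range N, A' (q.coeff i • Polynomial.X ^ i) := by
    refine Finset.sum_congr rfl fun i hi => ?_
    rw [map_smul, map_smul, h i (Finset.mem_range.1 hi)]
  rw [this]
  ring

/-- All lower moments agree, so the power of X may be replaced by any monic polynomial of that
degree. The choice Pₙ · X · Pₙ, with Pₙ common to both functionals, isolates βₙ; for γₙ the choice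
is Pₙ₊₁². -/
theorem jacobiFunctional_sub_odd {β γ β' γ' : ℕ → ℝ} (n : ℕ) (hβ : ∀ k < n, β k = β' k)
    (hγ : ∀ k < n, γ k = γ' k) (h : ∀ k ≤ 2 * n, jacobiFunctional β γ (Polynomial.X ^ k) =
      jacobiFunctional β' γ' (Polynomial.X ^ k)) :
    jacobiFunctional β γ (Polynomial.X ^ (2 * n + 1)) -
      jacobiFunctional β' γ' (Polynomial.X ^ (2 * n + 1)) =
      (∏ k ∈ Finset.range n, γ' k) * (β n - β' n) := by
  have hP : jacobiPolynomial β γ n = jacobiPolynomial β' γ' n :=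
    jacobiPolynomial_congr n hβ fun k hk => hγ k (by omega)
  have hm := jacobiPolynomial_monic β γ n
  rw [sub_apply_X_pow_eq (fun k hk => h k (by omega))
    (hm.mul (Polynomial.monic_X.mul hm)) ?_, jacobiFunctional_mul_X_mul, hP,
    jacobiFunctional_mul_X_mul, mul_sub,
    Finset.prod_congr rfl fun k hk => hγ k (Finset.mem_range.1 hk)]
  rw [hm.natDegree_mul (Polynomial.monic_X.mul hm), Polynomial.monic_X.natDegree_mul hm,
    natDegree_jacobiPolynomial, Polynomial.natDegree_X]
  ring

theorem jacobiFunctional_sub_even {β γ β' γ' : ℕ → ℝ} (n : ℕ) (hβ : ∀ k ≤ n, β k = β' k)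
    (hγ : ∀ k < n, γ k = γ' k) (h : ∀ k ≤ 2 * n + 1, jacobiFunctional β γ (Polynomial.X ^ k) =
      jacobiFunctional β' γ' (Polynomial.X ^ k)) :
    jacobiFunctional β γ (Polynomial.X ^ (2 * n + 2)) -
      jacobiFunctional β' γ' (Polynomial.X ^ (2 * n + 2)) =
      (∏ k ∈ Finset.range n, γ' k) * (γ n - γ' n) := by
  have hP : jacobiPolynomial β γ (n + 1) = jacobiPolynomial β' γ' (n + 1) :=
    jacobiPolynomial_congr _ (fun k hk => hβ k (by omega)) fun k hk => hγ k (by omega)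
  have hm := jacobiPolynomial_monic β γ (n + 1)
  rw [sub_apply_X_pow_eq (fun k hk => h k (by omega)) (hm.mul hm) ?_,
    jacobiFunctional_jacobiPolynomial_mul, hP, jacobiFunctional_jacobiPolynomial_mul,
    if_pos rfl, if_pos rfl, Finset.prod_range_succ, Finset.prod_range_succ,
    Finset.prod_congr rfl fun k hk => hγ k (Finset.mem_range.1 hk)]
  · ring
  · rw [hm.natDegree_mul hm, natDegree_jacobiPolynomial]
    ring

theorem jacobiFunctional_X_pow_congr {β γ β' γ' : ℕ → ℝ} (n : ℕ) (hβ : ∀ k < n, β k = β' k)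
    (hγ : ∀ k < n, γ k = γ' k) : ∀ k ≤ 2 * n, jacobiFunctional β γ (Polynomial.X ^ k) =
      jacobiFunctional β' γ' (Polynomial.X ^ k) := by
  induction n with
  | zero =>
    intro k hk
    obtain rfl : k = 0 := by omega
    simp [jacobiFunctional_one]
  | succ n ih =>
    have h := ih (fun k hk => hβ k (by omega)) (fun k hk => hγ k (by omega))
    have h1 : ∀ k ≤ 2 * n + 1, jacobiFunctional β γ (Polynomial.X ^ k) =
        jacobiFunctional β' γ' (Polynomial.X ^ k) := by
      intro k hk
      rcases Nat.lt_or_ge (2 * n) k with hk' | hk'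
      · obtain rfl : k = 2 * n + 1 := by omega
        have := jacobiFunctional_sub_odd n (fun k hk => hβ k (by omega))
          (fun k hk => hγ k (by omega)) h
        rw [hβ n (by omega), sub_self, mul_zero] at this
        exact sub_eq_zero.1 this
      · exact h k hk'
    intro k hk
    rcases Nat.lt_or_ge (2 * n + 1) k with hk' | hk'
    · obtain rfl : k = 2 * n + 2 := by omega
      have := jacobiFunctional_sub_even n (fun k hk => hβ k (by omega))
        (fun k hk => hγ k (by omega)) h1
      rw [hγ n (by omega), sub_self, mul_zero] at this
      exact sub_eq_zero.1 this
    · exact h1 k hk'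

/-- When γ₀ = 0, row 0 of the matrix is β₀ times the first coordinate and decouples from the rest.
-/
theorem jacobiFunctional_eq_eval {β γ : ℕ → ℝ} (hγ : γ 0 = 0) (p : Polynomial ℝ) :
    jacobiFunctional β γ p = p.eval (β 0) := by
  have key : ∀ n (v : ℕ → ℝ), (jacobiOperator β γ ^ n) v 0 = β 0 ^ n * v 0 := by
    intro n
    induction n with
    | zero => simp
    | succ n ih =>
      intro v
      rw [pow_succ, Module.End.mul_apply, ih, jacobiOperator_apply_zero, hγ]
      ring
  induction p using Polynomial.induction_on' with
  | add p q hp hq => rw [map_add, hp, hq, Polynomial.eval_add]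
  | monomial n a =>
    rw [jacobiFunctional_apply, Polynomial.aeval_monomial, Polynomial.eval_monomial,
      Module.End.mul_apply, Module.algebraMap_end_apply, Pi.smul_apply, key]
    simp

/-! ### Convolution of functionals and moment series -/

open scoped TensorProduct in
/-- The convolution of two linear functionals on polynomials: `p ↦ A_x (B_y (p (x + y)))`. -/
noncomputable def functionalConv (A B : Polynomial ℝ →ₗ[ℝ] ℝ) : Polynomial ℝ →ₗ[ℝ] ℝ :=
  (LinearMap.mul' ℝ ℝ ∘ₗ TensorProduct.map A B) ∘ₗ
    (Polynomial.aeval ((Polynomial.X ⊗ₜ[ℝ] 1 + 1 ⊗ₜ[ℝ] Polynomial.X :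
      Polynomial ℝ ⊗[ℝ] Polynomial ℝ))).toLinearMap

/-- The exponential generating function of the moments of a linear functional on polynomials. -/
noncomputable def momentSeries (A : Polynomial ℝ →ₗ[ℝ] ℝ) : PowerSeries ℝ :=
  PowerSeries.mk fun n => A (Polynomial.X ^ n) / n.factorial

theorem functionalConv_X_pow (A B : Polynomial ℝ →ₗ[ℝ] ℝ) (n : ℕ) :
    functionalConv A B (Polynomial.X ^ n) = ∑ k ∈ Finset.range (n + 1),
      A (Polynomial.X ^ k) * B (Polynomial.X ^ (n - k)) * n.choose k := by
  simp only [functionalConv, LinearMap.comp_apply, AlgHom.toLinearMap_apply, map_pow,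
    Polynomial.aeval_X]
  rw [add_pow, map_sum, map_sum]
  refine Finset.sum_congr rfl fun k _ => ?_
  rw [Algebra.TensorProduct.tmul_pow, Algebra.TensorProduct.tmul_pow,
    Algebra.TensorProduct.tmul_mul_tmul, one_pow, one_pow, one_mul, mul_one, mul_comm,
    ← nsmul_eq_mul, map_nsmul, map_nsmul, TensorProduct.map_tmul, LinearMap.mul'_apply,
    nsmul_eq_mul, mul_comm]

theorem momentSeries_functionalConv (A B : Polynomial ℝ →ₗ[ℝ] ℝ) :
    momentSeries (functionalConv A B) = momentSeries A * momentSeries B := by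
  ext n
  rw [PowerSeries.coeff_mul, Finset.Nat.sum_antidiagonal_eq_sum_range_succ_mk, momentSeries,
    PowerSeries.coeff_mk, functionalConv_X_pow, Finset.sum_div]
  refine Finset.sum_congr rfl fun k hk => ?_
  have hk' : k ≤ n := Nat.lt_succ_iff.1 (Finset.mem_range.1 hk)
  simp only [momentSeries, PowerSeries.coeff_mk]
  rw [Nat.cast_choose ℝ hk']
  field_simp

theorem momentSeries_injective {A B : Polynomial ℝ →ₗ[ℝ] ℝ}
    (h : momentSeries A = momentSeries B) : A = B := by
  refine Polynomial.lhom_ext' fun n => LinearMap.ext_ring ?_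
  have := congrArg (PowerSeries.coeff n) h
  simp only [momentSeries, PowerSeries.coeff_mk] at this
  rw [div_left_inj' (by positivity)] at this
  simpa [Polynomial.X_pow_eq_monomial] using this

theorem constantCoeff_momentSeries {A : Polynomial ℝ →ₗ[ℝ] ℝ} (h : A 1 = 1) :
    PowerSeries.constantCoeff (momentSeries A) = 1 := by
  rw [← PowerSeries.coeff_zero_eq_constantCoeff_apply]
  simp [momentSeries, h]

/-! ### Generating functions of Meixner polynomials -/

section MeixnerRecurrence

variable {R : Type*} [CommRing R] [Algebra ℝ R]

/-- Exponential generating function of a sequence. -/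
noncomputable def expSeries (p : ℕ → R) : PowerSeries R :=
  PowerSeries.mk fun n => ((n.factorial : ℝ)⁻¹) • p n

theorem expSeries_mul (p q : ℕ → R) : expSeries p * expSeries q =
    expSeries fun n => ∑ k ∈ Finset.range (n + 1), (n.choose k : ℝ) • (p k * q (n - k)) := by
  ext n
  rw [PowerSeries.coeff_mul, Finset.Nat.sum_antidiagonal_eq_sum_range_succ_mk]
  simp only [expSeries, PowerSeries.coeff_mk]
  rw [Finset.smul_sum]
  refine Finset.sum_congr rfl fun k hk => ?_
  have hk' : k ≤ n := Nat.lt_succ_iff.1 (Finset.mem_range.1 hk)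
  rw [smul_mul_smul_comm, smul_smul, Nat.cast_choose ℝ hk']
  congr 1
  field_simp

/-- The recurrence of the Meixner polynomials is equivalent to a linear first order differential
equation for the exponential generating function. -/
theorem meixner_recurrence_iff (x b c β γ : R) (p : ℕ → R) :
    (∀ n : ℕ, p (n + 1) = (x - n * b - β) * p n - n * ((n - 1) * c + γ) * p (n - 1)) ↔
      (1 + PowerSeries.C b * PowerSeries.X + PowerSeries.C c * PowerSeries.X ^ 2) *
        PowerSeries.derivative R (expSeries p) =
      (PowerSeries.C (x - β) - PowerSeries.C γ * PowerSeries.X) * expSeries p := by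
  have fact : ∀ n : ℕ, ((n.factorial : ℝ)) ≠ 0 := fun n => by positivity
  have hD : ∀ n : ℕ, PowerSeries.coeff n (PowerSeries.derivative R (expSeries p)) =
      ((n.factorial : ℝ)⁻¹) • p (n + 1) := by
    intro n
    rw [PowerSeries.coeff_derivative, expSeries, PowerSeries.coeff_mk,
      show (n + 1 : R) = algebraMap ℝ R (n + 1) by simp, mul_comm, ← Algebra.smul_def, smul_smul]
    congr 1
    rw [Nat.factorial_succ]
    push_cast
    have := fact n
    field_simp
  have hE : ∀ n : ℕ, PowerSeries.coeff n (expSeries p) = ((n.factorial : ℝ)⁻¹) • p n := by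
    intro n
    rw [expSeries, PowerSeries.coeff_mk]
  rw [PowerSeries.ext_iff]
  refine forall_congr' fun n => ?_
  set D := PowerSeries.derivative R (expSeries p)
  have e1 : (1 + PowerSeries.C b * PowerSeries.X + PowerSeries.C c * PowerSeries.X ^ 2) * D =
    D + PowerSeries.C b * (PowerSeries.X * D) +
      PowerSeries.C c * (PowerSeries.X * (PowerSeries.X * D)) := by ring
  -- Naming x − β keeps it a single atom while coefficients are compared.
  obtain ⟨δ, hδ⟩ : ∃ δ, δ = x - β := ⟨_, rfl⟩
  rw [← hδ, show x - n * b - β = δ - n * b by rw [hδ]; ring]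
  have e2 : (PowerSeries.C δ - PowerSeries.C γ * PowerSeries.X) * expSeries p =
    PowerSeries.C δ * expSeries p - PowerSeries.C γ * (PowerSeries.X * expSeries p) := by
    ring
  have hX : ∀ (n : ℕ) (f : PowerSeries R), (n.factorial : ℝ) • PowerSeries.coeff n
      (PowerSeries.X * f) = (n : R) * (((n - 1).factorial : ℝ) • PowerSeries.coeff (n - 1) f) := by
    intro n f
    rcases n with _ | n
    · simp
    · rw [PowerSeries.coeff_succ_X_mul, Nat.factorial_succ]
      simp [Algebra.smul_def]
      ring
  have hD' : ∀ n : ℕ, (n.factorial : ℝ) • PowerSeries.coeff n D = p (n + 1) := by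
    intro n
    rw [hD, smul_smul, mul_inv_cancel₀ (fact n), one_smul]
  have hE' : ∀ n : ℕ, (n.factorial : ℝ) • PowerSeries.coeff n (expSeries p) = p n := by
    intro n
    rw [hE, smul_smul, mul_inv_cancel₀ (fact n), one_smul]
  rw [e1, e2, ← (IsUnit.mk0 _ (fact n)).smul_left_cancel (x := PowerSeries.coeff n _)]
  simp only [map_add, map_sub, PowerSeries.coeff_C_mul, smul_add, smul_sub,
    ← mul_smul_comm, hD', hE', hX]
  rcases n with _ | _ | n
  · simp
  · simp
    constructor <;> intro h <;> linear_combination h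
  · simp
    constructor <;> intro h <;> linear_combination h

theorem meixner_recurrence_unique {R : Type*} [CommRing R] {x b c β γ : R} {p q : ℕ → R}
    (h0 : p 0 = q 0)
    (hp : ∀ n : ℕ, p (n + 1) = (x - n * b - β) * p n - n * ((n - 1) * c + γ) * p (n - 1))
    (hq : ∀ n : ℕ, q (n + 1) = (x - n * b - β) * q n - n * ((n - 1) * c + γ) * q (n - 1)) :
    p = q := by
  ext n
  induction n using Nat.strong_induction_on with
  | _ n ih =>
    rcases n with _ | n
    · exact h0
    · rw [hp, hq, ih n (by omega), ih (n - 1) (by omega)]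

/-- The two differential equations share the coefficient 1 + bz + cz², so by the Leibniz rule the
product of the generating functions solves the equation with added right-hand factors. The
recurrence and the initial value determine the sequence. -/
theorem meixner_recurrence_add {x y b c β γ β' γ' : R} {p q r : ℕ → R} (hp0 : p 0 = 1)
    (hq0 : q 0 = 1) (hr0 : r 0 = 1)
    (hp : ∀ n : ℕ, p (n + 1) = (x - n * b - β) * p n - n * ((n - 1) * c + γ) * p (n - 1))
    (hq : ∀ n : ℕ, q (n + 1) = (y - n * b - β') * q n - n * ((n - 1) * c + γ') * q (n - 1))
    (hr : ∀ n : ℕ, r (n + 1) = (x + y - n * b - (β + β')) * r n -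
      n * ((n - 1) * c + (γ + γ')) * r (n - 1)) (n : ℕ) :
    r n = ∑ k ∈ Finset.range (n + 1), (n.choose k : ℝ) • (p k * q (n - k)) := by
  refine congrFun (meixner_recurrence_unique (q := fun n => ∑ k ∈ Finset.range (n + 1),
    (n.choose k : ℝ) • (p k * q (n - k))) (by simp [hp0, hq0, hr0]) hr ?_) n
  rw [meixner_recurrence_iff] at hp hq
  refine (meixner_recurrence_iff (x + y) b c (β + β') (γ + γ')
    (fun n => ∑ k ∈ Finset.range (n + 1), (n.choose k : ℝ) • (p k * q (n - k)))).2 ?_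
  rw [← expSeries_mul, Derivation.leibniz, smul_eq_mul, smul_eq_mul]
  simp only [map_add, map_sub] at hp hq ⊢
  linear_combination expSeries p * hq + expSeries q * hp

end MeixnerRecurrence

/-! ### Convolution of Meixner functionals -/

/-- The functional with the Jacobi parameters `n b + β`, `(n + 1) (n c + γ)`. -/
noncomputable def meixnerFunctional (b c β γ : ℝ) : Polynomial ℝ →ₗ[ℝ] ℝ :=
  jacobiFunctional (fun n => (n : ℝ) * b + β) (fun n => ((n : ℝ) + 1) * ((n : ℝ) * c + γ))

theorem aeval_meixner_recurrence {R : Type*} [CommRing R] [Algebra ℝ R] (b c β γ : ℝ) (x : R)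
    (n : ℕ) :
    Polynomial.aeval x (jacobiPolynomial (fun n => (n : ℝ) * b + β)
      (fun n => ((n : ℝ) + 1) * ((n : ℝ) * c + γ)) (n + 1)) =
    (x - n * algebraMap ℝ R b - algebraMap ℝ R β) *
      Polynomial.aeval x (jacobiPolynomial (fun n => (n : ℝ) * b + β)
        (fun n => ((n : ℝ) + 1) * ((n : ℝ) * c + γ)) n) -
      n * ((n - 1) * algebraMap ℝ R c + algebraMap ℝ R γ) *
        Polynomial.aeval x (jacobiPolynomial (fun n => (n : ℝ) * b + β)
          (fun n => ((n : ℝ) + 1) * ((n : ℝ) * c + γ)) (n - 1)) := by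
  rcases n with _ | n
  · simp [jacobiPolynomial]
  · simp only [jacobiPolynomial, map_sub, map_mul, Polynomial.aeval_X, Polynomial.aeval_C, map_add,
      map_natCast, map_one, Nat.add_sub_cancel, Nat.cast_add, Nat.cast_one]
    ring

-- In the binomial expansion of Pₙ₊₁(x + y) every term has a factor of positive index, in x or in y,
-- and the corresponding functional kills it. Vanishing on all Pₙ₊₁ characterises the functional on
-- the right.
open scoped TensorProduct in
theorem functionalConv_meixnerFunctional (b c β γ β' γ' : ℝ) :
    functionalConv (meixnerFunctional b c β γ) (meixnerFunctional b c β' γ') =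
      meixnerFunctional b c (β + β') (γ + γ') := by
  have hzero : ∀ β γ : ℝ, ∀ n, meixnerFunctional b c β γ (jacobiPolynomial
      (fun n => (n : ℝ) * b + β) (fun n => ((n : ℝ) + 1) * ((n : ℝ) * c + γ)) (n + 1)) = 0 := by
    intro β γ n
    rw [meixnerFunctional, jacobiFunctional_apply, aeval_jacobiPolynomial_single]
    simp
  refine eq_jacobiFunctional ?_ fun n => ?_
  · have := functionalConv_X_pow (meixnerFunctional b c β γ) (meixnerFunctional b c β' γ') 0
    simpa [meixnerFunctional, jacobiFunctional_one] using this
  · simp only [functionalConv, LinearMap.comp_apply, AlgHom.toLinearMap_apply]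
    set x : Polynomial ℝ ⊗[ℝ] Polynomial ℝ := Polynomial.X ⊗ₜ[ℝ] 1 with hx
    set y : Polynomial ℝ ⊗[ℝ] Polynomial ℝ := 1 ⊗ₜ[ℝ] Polynomial.X with hy
    have hxp : ∀ p : Polynomial ℝ, Polynomial.aeval x p = p ⊗ₜ[ℝ] 1 := by
      intro p
      have := Polynomial.aeval_algHom_apply (Algebra.TensorProduct.includeLeft :
        Polynomial ℝ →ₐ[ℝ] Polynomial ℝ ⊗[ℝ] Polynomial ℝ) Polynomial.X p
      simpa [hx] using this
    have hyp : ∀ p : Polynomial ℝ, Polynomial.aeval y p = 1 ⊗ₜ[ℝ] p := by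
      intro p
      have := Polynomial.aeval_algHom_apply (Algebra.TensorProduct.includeRight :
        Polynomial ℝ →ₐ[ℝ] Polynomial ℝ ⊗[ℝ] Polynomial ℝ) Polynomial.X p
      simpa [hy] using this
    have hr := aeval_meixner_recurrence b c (β + β') (γ + γ') (x + y)
    simp only [map_add (algebraMap ℝ (Polynomial ℝ ⊗[ℝ] Polynomial ℝ))] at hr
    rw [meixner_recurrence_add
      (p := fun n => Polynomial.aeval x (jacobiPolynomial _ _ n))
      (q := fun n => Polynomial.aeval y (jacobiPolynomial _ _ n))
      (r := fun n => Polynomial.aeval (x + y) (jacobiPolynomial _ _ n))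
      (by simp [jacobiPolynomial]) (by simp [jacobiPolynomial]) (by simp [jacobiPolynomial])
      (aeval_meixner_recurrence b c β γ x) (aeval_meixner_recurrence b c β' γ' y) hr (n + 1),
      map_sum, map_sum]
    refine Finset.sum_eq_zero fun k hk => ?_
    rw [hxp, hyp, Algebra.TensorProduct.tmul_mul_tmul, one_mul, mul_one, map_smul, map_smul,
      TensorProduct.map_tmul, LinearMap.mul'_apply]
    rcases k with _ | k
    · rw [Nat.sub_zero, hzero, mul_zero, smul_zero]
    · rw [hzero, zero_mul, smul_zero]

theorem momentSeries_meixnerFunctional_add (b c β γ β' γ' : ℝ) :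
    momentSeries (meixnerFunctional b c (β + β') (γ + γ')) =
      momentSeries (meixnerFunctional b c β γ) * momentSeries (meixnerFunctional b c β' γ') := by
  rw [← functionalConv_meixnerFunctional, momentSeries_functionalConv]

theorem meixnerFunctional_one (b c β γ : ℝ) : meixnerFunctional b c β γ 1 = 1 :=
  jacobiFunctional_one _ _

theorem constantCoeff_momentSeries_meixnerFunctional (b c β γ : ℝ) :
    PowerSeries.constantCoeff (momentSeries (meixnerFunctional b c β γ)) = 1 :=
  constantCoeff_momentSeries (meixnerFunctional_one _ _ _ _)

theorem momentSeries_meixnerFunctional_nat (b c β γ : ℝ) (n : ℕ) :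
    momentSeries (meixnerFunctional b c (β * (n + 1 : ℕ)) (γ * (n + 1 : ℕ))) =
      momentSeries (meixnerFunctional b c β γ) ^ (n + 1) := by
  induction n with
  | zero => simp
  | succ n ih =>
    rw [pow_succ, ← ih, ← momentSeries_meixnerFunctional_add]
    push_cast
    ring_nf

/-! ### First deviations and roots of power series -/

/-- In degree N only the top coefficients can deviate, and each is multiplied by a constant term
equal to 1. The first deviation is therefore additive under products. -/
theorem powerSeries_coeff_mul_sub {N : ℕ} (hN : N ≠ 0) {f g f' g' : PowerSeries ℝ}
    (h : ∀ k < N, PowerSeries.coeff k f = PowerSeries.coeff k g)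
    (h' : ∀ k < N, PowerSeries.coeff k f' = PowerSeries.coeff k g')
    (hf : PowerSeries.constantCoeff f = 1) (hf' : PowerSeries.constantCoeff f' = 1) :
    (∀ k < N, PowerSeries.coeff k (f * f') = PowerSeries.coeff k (g * g')) ∧
    PowerSeries.coeff N (f * f') - PowerSeries.coeff N (g * g') =
      (PowerSeries.coeff N f - PowerSeries.coeff N g) +
      (PowerSeries.coeff N f' - PowerSeries.coeff N g') := by
  have hg : PowerSeries.coeff 0 g = 1 := by
    rw [← h 0 (by omega), PowerSeries.coeff_zero_eq_constantCoeff_apply, hf]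
  have hg' : PowerSeries.coeff 0 g' = 1 := by
    rw [← h' 0 (by omega), PowerSeries.coeff_zero_eq_constantCoeff_apply, hf']
  constructor
  · intro k hk
    rw [PowerSeries.coeff_mul, PowerSeries.coeff_mul]
    refine Finset.sum_congr rfl fun i hi => ?_
    have hi := Finset.HasAntidiagonal.mem_antidiagonal.1 hi
    rw [h i.1 (by omega), h' i.2 (by omega)]
  · obtain ⟨M, rfl⟩ := Nat.exists_eq_succ_of_ne_zero hN
    simp only [Nat.succ_eq_add_one] at *
    have split : ∀ u v : PowerSeries ℝ, PowerSeries.coeff (M + 1) (u * v) =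
        ∑ k ∈ Finset.range M, PowerSeries.coeff (k + 1) u *
          PowerSeries.coeff (M + 1 - (k + 1)) v +
        PowerSeries.coeff 0 u * PowerSeries.coeff (M + 1) v +
        PowerSeries.coeff (M + 1) u * PowerSeries.coeff 0 v := by
      intro u v
      rw [PowerSeries.coeff_mul, Finset.Nat.sum_antidiagonal_eq_sum_range_succ_mk,
        Finset.sum_range_succ, Finset.sum_range_succ', Nat.sub_self, Nat.sub_zero]
    have hs : ∑ k ∈ Finset.range M, PowerSeries.coeff (k + 1) f *
          PowerSeries.coeff (M + 1 - (k + 1)) f' =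
        ∑ k ∈ Finset.range M, PowerSeries.coeff (k + 1) g *
          PowerSeries.coeff (M + 1 - (k + 1)) g' := by
      refine Finset.sum_congr rfl fun i hi => ?_
      rw [Finset.mem_range] at hi
      rw [h (i + 1) (by omega), h' _ (by omega)]
    rw [split, split, hs, h 0 (by omega), h' 0 (by omega), hg, hg']
    ring

theorem powerSeries_coeff_pow_sub {N : ℕ} (hN : N ≠ 0) {f g : PowerSeries ℝ}
    (h : ∀ k < N, PowerSeries.coeff k f = PowerSeries.coeff k g)
    (hf : PowerSeries.constantCoeff f = 1) (n : ℕ) :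
    (∀ k < N, PowerSeries.coeff k (f ^ n) = PowerSeries.coeff k (g ^ n)) ∧
    PowerSeries.coeff N (f ^ n) - PowerSeries.coeff N (g ^ n) =
      n * (PowerSeries.coeff N f - PowerSeries.coeff N g) := by
  induction n with
  | zero => simp
  | succ n ih =>
    have := powerSeries_coeff_mul_sub hN ih.1 h (by simp [hf]) hf
    refine ⟨by simpa only [pow_succ] using this.1, ?_⟩
    rw [pow_succ, pow_succ, this.2, ih.2]
    push_cast
    ring

theorem powerSeries_eq_of_pow_eq {f g : PowerSeries ℝ} (hf : PowerSeries.constantCoeff f = 1)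
    (hg : PowerSeries.constantCoeff g = 1) {n : ℕ} (hn : n ≠ 0) (h : f ^ n = g ^ n) : f = g := by
  ext N
  induction N using Nat.strong_induction_on with
  | _ N ih =>
    rcases eq_or_ne N 0 with rfl | hN
    · rw [PowerSeries.coeff_zero_eq_constantCoeff_apply,
        PowerSeries.coeff_zero_eq_constantCoeff_apply, hf, hg]
    · have := (powerSeries_coeff_pow_sub hN ih hf n).2
      rw [h, sub_self, eq_comm, mul_eq_zero, sub_eq_zero] at this
      exact this.resolve_left (by exact_mod_cast hn)

/-! ### Growth and continuity of the moments -/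

/-- The weight k! splits the quadratic growth of γ: one factor k + 1 turns k! into (k+1)!, and the
other is bounded through the support condition k ≤ n. Each of the three diagonals then costs at most
A(n + 2) per step. -/
theorem abs_jacobiOperator_pow_single_le {β γ : ℕ → ℝ} {a : ℝ}
    (hβ : ∀ n : ℕ, |β n| ≤ a * (n + 1)) (hγ : ∀ n : ℕ, |γ n| ≤ a * (n + 1) ^ 2) (n : ℕ) :
    ∀ k, |(jacobiOperator β γ ^ n) (Pi.single 0 1) k| * k.factorial ≤
      (3 * max a 1) ^ n * (n + 1).factorial ∧
      (n < k → (jacobiOperator β γ ^ n) (Pi.single 0 1) k = 0) := by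
  set A := max a 1 with hA
  have hA1 : 1 ≤ A := le_max_right _ _
  have haA : a ≤ A := le_max_left _ _
  induction n with
  | zero =>
    intro k
    rcases k with _ | k <;> simp
  | succ n ih =>
    intro k
    rw [pow_succ', Module.End.mul_apply]
    set v := (jacobiOperator β γ ^ n) (Pi.single 0 1) with hv
    set M : ℝ := (3 * A) ^ n * (n + 1).factorial with hM
    have hM0 : 0 ≤ M := by positivity
    have hgoal : (3 * A) ^ (n + 1) * ((n + 1 + 1).factorial : ℝ) = 3 * (A * (n + 2) * M) := by
      rw [hM, Nat.factorial_succ (n + 1)]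
      push_cast
      ring
    have diag : ∀ k, |β k * v k| * k.factorial ≤ A * (n + 2) * M := by
      intro k
      rcases Nat.lt_or_ge n k with h | h
      · rw [(ih k).2 h]
        simp only [mul_zero, abs_zero, zero_mul]
        positivity
      · have hk : (k : ℝ) ≤ n := by exact_mod_cast h
        rw [abs_mul, mul_assoc]
        refine mul_le_mul ((hβ k).trans ?_) (ih k).1 (by positivity) (by positivity)
        exact mul_le_mul haA (by linarith) (by positivity) (by positivity)
    have upper : ∀ k, |γ k * v (k + 1)| * k.factorial ≤ A * (n + 2) * M := by
      intro k
      rcases Nat.lt_or_ge n k with h | h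
      · rw [(ih (k + 1)).2 (by omega)]
        simp only [mul_zero, abs_zero, zero_mul]
        positivity
      · have hk : (k : ℝ) ≤ n := by exact_mod_cast h
        have h1 : |γ k| ≤ A * (n + 2) * (k + 1) := by
          refine (hγ k).trans ?_
          rw [pow_two, ← mul_assoc]
          gcongr
          linarith
        calc |γ k * v (k + 1)| * k.factorial
            ≤ (A * (n + 2) * (k + 1)) * |v (k + 1)| * k.factorial := by
              rw [abs_mul]
              gcongr
          _ = A * (n + 2) * (|v (k + 1)| * (k + 1).factorial) := by
              rw [Nat.factorial_succ]
              push_cast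
              ring
          _ ≤ A * (n + 2) * M := by
              gcongr
              exact (ih (k + 1)).1
    constructor
    · rw [hgoal]
      rcases k with _ | k
      · rw [jacobiOperator_apply_zero]
        have h1 := diag 0
        have h2 := upper 0
        have h3 : 0 ≤ A * (n + 2) * M := by positivity
        simp only [Nat.factorial_zero, Nat.cast_one, mul_one] at *
        refine (abs_add_le _ _).trans ?_
        simp only [zero_add] at h2
        linarith
      · rw [jacobiOperator_apply_succ]
        have h1 := diag (k + 1)
        have h2 := upper (k + 1)
        have h3 : |v k| * (k + 1).factorial ≤ A * (n + 2) * M := by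
          rcases Nat.lt_or_ge n k with h | h
          · rw [(ih k).2 h]
            simp only [abs_zero, zero_mul]
            positivity
          · have hk : (k : ℝ) ≤ n := by exact_mod_cast h
            rw [Nat.factorial_succ]
            push_cast
            calc |v k| * ((k + 1) * k.factorial) = (1 * (k + 1)) * (|v k| * k.factorial) := by ring
              _ ≤ (A * (n + 2)) * M := by
                have := (ih k).1
                gcongr
                linarith
        calc |v k + β (k + 1) * v (k + 1) + γ (k + 1) * v (k + 2)| * (k + 1).factorial
            ≤ (|v k| + |β (k + 1) * v (k + 1)| + |γ (k + 1) * v (k + 2)|) *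
              (k + 1).factorial := by
              gcongr
              exact abs_add_three _ _ _
          _ ≤ 3 * (A * (n + 2) * M) := by
              rw [add_mul, add_mul]
              linarith
    · intro hk
      obtain ⟨k, rfl⟩ := Nat.exists_eq_succ_of_ne_zero (by omega : k ≠ 0)
      rw [Nat.succ_eq_add_one, jacobiOperator_apply_succ, (ih k).2 (by omega),
        (ih (k + 1)).2 (by omega), (ih (k + 2)).2 (by omega)]
      ring

theorem meixnerFunctional_X_pow (b c β γ : ℝ) (n : ℕ) :
    meixnerFunctional b c β γ (Polynomial.X ^ n) =
      (jacobiOperator (fun n => (n : ℝ) * b + β)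
        (fun n => ((n : ℝ) + 1) * ((n : ℝ) * c + γ)) ^ n) (Pi.single 0 1) 0 := by
  rw [meixnerFunctional, jacobiFunctional_apply, map_pow, Polynomial.aeval_X]

theorem exists_abs_meixnerFunctional_le (b c β γ : ℝ) : ∃ C : ℝ, 0 < C ∧ ∀ n : ℕ,
    |meixnerFunctional b c β γ (Polynomial.X ^ n)| ≤ C ^ n * (n + 1).factorial := by
  refine ⟨3 * max (|b| + |β| + |c| + |γ|) 1, by positivity, fun n => ?_⟩
  rw [meixnerFunctional_X_pow]
  have key := fun hβ hγ => (abs_jacobiOperator_pow_single_le (a := |b| + |β| + |c| + |γ|)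
    (β := fun n => (n : ℝ) * b + β) (γ := fun n => ((n : ℝ) + 1) * ((n : ℝ) * c + γ)) hβ hγ n 0).1
  simp only [Nat.factorial_zero, Nat.cast_one, mul_one] at key
  refine key (fun n => ?_) (fun n => ?_)
  · refine (abs_add_le _ _).trans ?_
    rw [abs_mul, Nat.abs_cast]
    have := abs_nonneg b
    have := abs_nonneg c
    have := abs_nonneg β
    have := abs_nonneg γ
    have hn : (0 : ℝ) ≤ n := by positivity
    nlinarith [mul_nonneg hn (abs_nonneg β), mul_nonneg hn (abs_nonneg c),
      mul_nonneg hn (abs_nonneg γ)]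
  · rw [abs_mul, abs_of_nonneg (by positivity : (0 : ℝ) ≤ n + 1), pow_two, ← mul_assoc,
      mul_comm _ ((n : ℝ) + 1)]
    refine mul_le_mul_of_nonneg_left ?_ (by positivity)
    refine (abs_add_le _ _).trans ?_
    rw [abs_mul, Nat.abs_cast]
    have := abs_nonneg b
    have := abs_nonneg c
    have := abs_nonneg β
    have := abs_nonneg γ
    have hn : (0 : ℝ) ≤ n := by positivity
    nlinarith [mul_nonneg hn (abs_nonneg β), mul_nonneg hn (abs_nonneg b),
      mul_nonneg hn (abs_nonneg γ)]

theorem continuous_meixnerFunctional_X_pow (b c β γ : ℝ) (n : ℕ) :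
    Continuous fun t : ℝ => meixnerFunctional b c (β * t) (γ * t) (Polynomial.X ^ n) := by
  simp only [meixnerFunctional_X_pow]
  suffices h : ∀ k, Continuous fun t : ℝ => (jacobiOperator (fun n => (n : ℝ) * b + β * t)
      (fun n => ((n : ℝ) + 1) * ((n : ℝ) * c + γ * t)) ^ n) (Pi.single 0 1) k from h 0
  have hβ : ∀ k : ℕ, Continuous fun t : ℝ => (k : ℝ) * b + β * t := fun k => by fun_prop
  have hγ : ∀ k : ℕ, Continuous fun t : ℝ => ((k : ℝ) + 1) * ((k : ℝ) * c + γ * t) :=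
    fun k => by fun_prop
  induction n with
  | zero => exact fun k => continuous_const
  | succ n ih =>
    intro k
    simp only [pow_succ', Module.End.mul_apply]
    rcases k with _ | k
    · simp only [jacobiOperator_apply_zero]
      exact ((hβ 0).mul (ih 0)).add ((hγ 0).mul (ih 1))
    · simp only [jacobiOperator_apply_succ]
      exact ((ih k).add ((hβ (k + 1)).mul (ih (k + 1)))).add ((hγ (k + 1)).mul (ih (k + 2)))

/-! ### Measures and their moment functionals -/

/-- All moments of `μ` are finite and they are given by the linear functional `A`. -/
def HasMoments (μ : Measure ℝ) (A : Polynomial ℝ →ₗ[ℝ] ℝ) : Prop :=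
  (∀ m : ℕ, Integrable (fun x : ℝ => x ^ m) μ) ∧ ∀ m : ℕ, ∫ x, x ^ m ∂μ = A (Polynomial.X ^ m)

theorem integrable_polynomial_eval {μ : Measure ℝ}
    (h : ∀ m : ℕ, Integrable (fun x : ℝ => x ^ m) μ) (p : Polynomial ℝ) :
    Integrable (fun x => p.eval x) μ := by
  simp only [Polynomial.eval_eq_sum_range]
  exact integrable_finsetSum _ fun i _ => (h i).const_mul _

theorem exists_hasMoments {μ : Measure ℝ} (h : ∀ m : ℕ, Integrable (fun x : ℝ => x ^ m) μ) :
    ∃ A, HasMoments μ A :=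
  ⟨{ toFun := fun p => ∫ x, p.eval x ∂μ
     map_add' := fun p q => by
       simp only [Polynomial.eval_add]
       exact integral_add (integrable_polynomial_eval h p) (integrable_polynomial_eval h q)
     map_smul' := fun a p => by
       simp only [Polynomial.eval_smul, smul_eq_mul, RingHom.id_apply]
       exact integral_const_mul _ _ }, h, fun m => by simp⟩

theorem HasMoments.integral_eval {μ : Measure ℝ} {A : Polynomial ℝ →ₗ[ℝ] ℝ} (h : HasMoments μ A)
    (p : Polynomial ℝ) : ∫ x, p.eval x ∂μ = A p := by
  conv_rhs => rw [p.as_sum_range_C_mul_X_pow]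
  simp only [Polynomial.eval_eq_sum_range, map_sum, Polynomial.C_mul', map_smul, smul_eq_mul]
  rw [integral_finsetSum _ fun i _ => (h.1 i).const_mul _]
  simp only [integral_const_mul, h.2]

theorem HasMoments.map_one {μ : Measure ℝ} [IsProbabilityMeasure μ] {A : Polynomial ℝ →ₗ[ℝ] ℝ}
    (h : HasMoments μ A) : A 1 = 1 := by
  simpa using (h.2 0).symm

theorem HasMoments.unique {μ : Measure ℝ} {A B : Polynomial ℝ →ₗ[ℝ] ℝ} (hA : HasMoments μ A)
    (hB : HasMoments μ B) : A = B :=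
  LinearMap.ext fun p => by rw [← hA.integral_eval, hB.integral_eval]

/-- Favard's theorem in algebraic form. -/
theorem hasJacobiParameters_iff {μ : Measure ℝ} [IsProbabilityMeasure μ] {β γ : ℕ → ℝ} :
    HasJacobiParameters μ β γ ↔ HasMoments μ (jacobiFunctional β γ) := by
  constructor
  · rintro ⟨h, ho⟩
    obtain ⟨A, hA⟩ := exists_hasMoments h
    rwa [← eq_jacobiFunctional hA.map_one fun n => ?_]
    rw [← hA.integral_eval]
    simpa [jacobiPolynomial] using ho (n + 1) 0 (by omega)
  · intro h
    refine ⟨h.1, fun m n hmn => ?_⟩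
    simp only [← Polynomial.eval_mul]
    rw [h.integral_eval, jacobiFunctional_jacobiPolynomial_mul, if_neg hmn]

/-- The product is ∫ Pₙ² dμ. This is the only source of sign restrictions on the parameters. -/
theorem HasMoments.prod_nonneg {μ : Measure ℝ} {β γ : ℕ → ℝ}
    (h : HasMoments μ (jacobiFunctional β γ)) (n : ℕ) : 0 ≤ ∏ k ∈ Finset.range n, γ k := by
  have := jacobiFunctional_jacobiPolynomial_mul β γ n n
  rw [if_pos rfl, ← h.integral_eval] at this
  rw [← this]
  refine integral_nonneg fun x => ?_
  rw [Polynomial.eval_mul]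
  exact mul_self_nonneg _

theorem HasMoments.conv {μ ν : Measure ℝ} [IsProbabilityMeasure μ] [IsProbabilityMeasure ν]
    {A B : Polynomial ℝ →ₗ[ℝ] ℝ} (hA : HasMoments μ A) (hB : HasMoments ν B) :
    HasMoments (Measure.conv μ ν) (functionalConv A B) := by
  have hint : ∀ m k : ℕ, Integrable (fun z : ℝ × ℝ => z.1 ^ k * z.2 ^ (m - k) * m.choose k)
      (μ.prod ν) := fun m k => ((hA.1 k).mul_prod (hB.1 (m - k))).mul_const _
  have hmeas : ∀ m : ℕ, AEStronglyMeasurable (fun x : ℝ => x ^ m) (Measure.conv μ ν) :=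
    fun m => (continuous_pow m).aestronglyMeasurable
  have hadd : AEMeasurable (fun z : ℝ × ℝ => z.1 + z.2) (μ.prod ν) := by fun_prop
  constructor
  · intro m
    have := hmeas m
    rw [Measure.conv] at this ⊢
    rw [integrable_map_measure this hadd]
    simp only [Function.comp_def, add_pow]
    exact integrable_finsetSum _ fun k _ => hint m k
  · intro m
    have := hmeas m
    rw [Measure.conv] at this ⊢
    rw [integral_map hadd this]
    simp only [add_pow]
    rw [integral_finsetSum _ fun k _ => hint m k, functionalConv_X_pow]
    refine Finset.sum_congr rfl fun k _ => ?_
    rw [integral_mul_const, integral_prod_mul (fun x : ℝ => x ^ k) (fun x : ℝ => x ^ (m - k)),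
      hA.2, hB.2]

/-- By Fubini, for some x all powers of x + y are ν-integrable in y; expanding y = (x + y) − x gives
the powers of y. -/
theorem integrable_pow_of_conv {μ ν : Measure ℝ} [IsProbabilityMeasure μ] [IsProbabilityMeasure ν]
    (h : ∀ m : ℕ, Integrable (fun x : ℝ => x ^ m) (Measure.conv μ ν)) (m : ℕ) :
    Integrable (fun x : ℝ => x ^ m) ν := by
  have h1 : ∀ᵐ x ∂μ, ∀ m : ℕ, Integrable (fun y => (x + y) ^ m) ν := by
    rw [ae_all_iff]
    intro m
    have := h m
    rw [integrable_conv_iff (by fun_prop)] at this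
    exact this.1
  obtain ⟨x, hx⟩ := h1.exists
  have : (fun y : ℝ => y ^ m) = fun y => ∑ k ∈ Finset.range (m + 1),
      (x + y) ^ k * (-x) ^ (m - k) * m.choose k := by
    ext y
    rw [← add_pow]
    ring
  rw [this]
  exact integrable_finsetSum _ fun k _ => ((hx k).mul_const _).mul_const _

/-! ### Determinacy of the moment problem -/

open ProbabilityTheory Filter Topology in
theorem complexMGF_eventuallyEq_of_moments_eq {μ ν : Measure ℝ}
    (hμ : (0 : ℝ) ∈ interior (integrableExpSet id μ))
    (hν : (0 : ℝ) ∈ interior (integrableExpSet id ν)) (h : ∀ n : ℕ, ∫ x, x ^ n ∂μ = ∫ x, x ^ n ∂ν) :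
    complexMGF id μ =ᶠ[𝓝 0] complexMGF id ν := by
  have h1 := (analyticAt_complexMGF (X := id) (μ := μ) (z := 0)
    (by simpa using hμ)).hasFPowerSeriesAt
  have h2 := (analyticAt_complexMGF (X := id) (μ := ν) (z := 0)
    (by simpa using hν)).hasFPowerSeriesAt
  have hd : ∀ n, iteratedDeriv n (complexMGF id μ) 0 = iteratedDeriv n (complexMGF id ν) 0 := by
    intro n
    rw [iteratedDeriv_complexMGF (by simpa using hμ), iteratedDeriv_complexMGF (by simpa using hν)]
    simp only [id, zero_mul, Complex.exp_zero, mul_one]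
    have := congrArg (fun r : ℝ => (r : ℂ)) (h n)
    simp only [← integral_complex_ofReal] at this
    simpa using this
  simp only [hd] at h1
  have h3 := h1.sub h2
  rw [sub_self] at h3
  filter_upwards [h3.eventually_eq_zero] with z hz
  exact sub_eq_zero.1 hz

-- The complex moment generating functions agree near 0, hence by the identity theorem on a strip
-- containing the imaginary axis, where they are the characteristic functions.
open ProbabilityTheory Filter Topology in
theorem measure_eq_of_moments_eq {μ ν : Measure ℝ} [IsFiniteMeasure μ] [IsFiniteMeasure ν]
    (hμ : (0 : ℝ) ∈ interior (integrableExpSet id μ))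
    (hν : (0 : ℝ) ∈ interior (integrableExpSet id ν))
    (h : ∀ n : ℕ, ∫ x, x ^ n ∂μ = ∫ x, x ^ n ∂ν) : μ = ν := by
  set S : Set ℝ := interior (integrableExpSet id μ) ∩ interior (integrableExpSet id ν) with hS
  have hconv : Convex ℝ S := convex_integrableExpSet.interior.inter convex_integrableExpSet.interior
  have hX : AnalyticOnNhd ℂ (complexMGF id μ) {z | z.re ∈ S} :=
    analyticOnNhd_complexMGF.mono fun z hz => hz.1
  have hY : AnalyticOnNhd ℂ (complexMGF id ν) {z | z.re ∈ S} :=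
    analyticOnNhd_complexMGF.mono fun z hz => hz.2
  have heq := hX.eqOn_of_preconnected_of_eventuallyEq hY
    (hconv.linear_preimage Complex.reLm).isPreconnected (z₀ := 0)
    (show (0 : ℂ).re ∈ S from by simpa using ⟨hμ, hν⟩)
    (complexMGF_eventuallyEq_of_moments_eq hμ hν h)
  refine Measure.ext_of_charFun (funext fun t => ?_)
  rw [← complexMGF_id_mul_I, ← complexMGF_id_mul_I]
  exact heq (show (t * Complex.I).re ∈ S from by simpa using ⟨hμ, hν⟩)

-- Even moments suffice: for |t| < 1/C the integral of cosh(tx) is at most ∑ (2n + 1)(tC)²ⁿ, and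
-- exp(tx) ≤ 2 cosh(tx).
open ProbabilityTheory in
theorem HasMoments.zero_mem_interior_integrableExpSet {μ : Measure ℝ}
    {A : Polynomial ℝ →ₗ[ℝ] ℝ} (h : HasMoments μ A) {C : ℝ} (hC : 0 < C)
    (hA : ∀ n : ℕ, |A (Polynomial.X ^ n)| ≤ C ^ n * (n + 1).factorial) :
    (0 : ℝ) ∈ interior (integrableExpSet id μ) := by
  rw [mem_interior]
  refine ⟨Set.Ioo (-C⁻¹) C⁻¹, fun t ht => ?_, isOpen_Ioo, by simp [hC]⟩
  set r := (t * C) ^ 2 with hr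
  have hr1 : |r| < 1 := by
    have : |t * C| < 1 := by
      rw [abs_mul, abs_of_pos hC, ← lt_div_iff₀ hC, one_div]
      exact abs_lt.2 ht
    rw [hr, abs_pow]
    exact pow_lt_one₀ (abs_nonneg _) this two_ne_zero
  have hsum : Summable fun n : ℕ => (2 * n + 1 : ℝ) * r ^ n := by
    have h1 := summable_pow_mul_geometric_of_norm_lt_one 1 (r := r) (by simpa using hr1)
    have h0 := summable_geometric_of_norm_lt_one (x := r) (by simpa using hr1)
    refine ((h1.mul_left 2).add h0).congr fun n => ?_
    ring
  have hterm : ∀ n : ℕ, ∫⁻ x, ENNReal.ofReal ((t * x) ^ (2 * n) / (2 * n).factorial) ∂μ ≤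
      ENNReal.ofReal ((2 * n + 1 : ℝ) * r ^ n) := by
    intro n
    have hi : Integrable (fun x : ℝ => (t * x) ^ (2 * n) / (2 * n).factorial) μ := by
      simp only [mul_pow]
      exact ((h.1 (2 * n)).const_mul _).div_const _
    rw [← ofReal_integral_eq_lintegral_ofReal hi (Filter.Eventually.of_forall fun x =>
      div_nonneg (Even.pow_nonneg (even_two_mul n) _) (by positivity))]
    refine ENNReal.ofReal_le_ofReal ?_
    simp only [mul_pow]
    rw [integral_div, integral_const_mul, h.2, div_le_iff₀ (by positivity)]
    refine (mul_le_mul_of_nonneg_left ((le_abs_self _).trans (hA (2 * n)))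
      (Even.pow_nonneg (even_two_mul n) _)).trans (le_of_eq ?_)
    rw [Nat.factorial_succ, hr]
    push_cast
    ring
  have hcosh : ∫⁻ x, ENNReal.ofReal (Real.cosh (t * x)) ∂μ < ⊤ := by
    have hc : ∀ x : ℝ, ENNReal.ofReal (Real.cosh (t * x)) =
        ∑' n : ℕ, ENNReal.ofReal ((t * x) ^ (2 * n) / (2 * n).factorial) := by
      intro x
      have hs := Real.hasSum_cosh (t * x)
      rw [← hs.tsum_eq, ENNReal.ofReal_tsum_of_nonneg (fun n =>
        div_nonneg (Even.pow_nonneg (even_two_mul n) _) (by positivity)) hs.summable]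
    simp only [hc]
    rw [lintegral_tsum fun n => by fun_prop]
    refine (ENNReal.tsum_le_tsum hterm).trans_lt ?_
    rw [← ENNReal.ofReal_tsum_of_nonneg _ hsum]
    · exact ENNReal.ofReal_lt_top
    · intro n
      rw [hr]
      positivity
  have hcoshi : Integrable (fun x : ℝ => Real.cosh (t * x)) μ := by
    refine ⟨by fun_prop, ?_⟩
    rw [hasFiniteIntegral_iff_ofReal (Filter.Eventually.of_forall fun x => (Real.cosh_pos _).le)]
    exact hcosh
  refine (hcoshi.const_mul 2).mono' (by fun_prop) (Filter.Eventually.of_forall fun x => ?_)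
  rw [Real.norm_eq_abs, Real.abs_exp, Real.cosh_eq, id]
  have := Real.exp_pos (-(t * x))
  linarith

theorem HasMoments.measure_eq {μ ν : Measure ℝ} [IsFiniteMeasure μ] [IsFiniteMeasure ν]
    {A : Polynomial ℝ →ₗ[ℝ] ℝ} (hμ : HasMoments μ A) (hν : HasMoments ν A) {C : ℝ} (hC : 0 < C)
    (hA : ∀ n : ℕ, |A (Polynomial.X ^ n)| ≤ C ^ n * (n + 1).factorial) : μ = ν :=
  measure_eq_of_moments_eq (hμ.zero_mem_interior_integrableExpSet hC hA)
    (hν.zero_mem_interior_integrableExpSet hC hA) fun n => by rw [hμ.2, hν.2]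

/-! ### Moments of weak limits -/

open Filter Topology in
/-- A weak limit of measures whose moments converge has the limits as its moments. -/
theorem hasMoments_of_tendsto {μ : ProbabilityMeasure ℝ} {μs : ℕ → ProbabilityMeasure ℝ}
    (hlim : Tendsto μs atTop (𝓝 μ)) {A : Polynomial ℝ →ₗ[ℝ] ℝ}
    {As : ℕ → Polynomial ℝ →ₗ[ℝ] ℝ} (h : ∀ i, HasMoments (μs i) (As i))
    (hA : ∀ n : ℕ, Tendsto (fun i => As i (Polynomial.X ^ n)) atTop (𝓝 (A (Polynomial.X ^ n)))) :
    HasMoments μ A := by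
  -- Weak convergence alone gives lower semicontinuity of integrals of nonnegative continuous
  -- functions. The resulting bound on even moments supplies both integrability and uniform control
  -- of tails.
  have heven : ∀ n : ℕ, ∫⁻ x, ENNReal.ofReal (x ^ (2 * n)) ∂(μ : Measure ℝ) ≤
      ENNReal.ofReal (A (Polynomial.X ^ (2 * n))) := by
    intro n
    refine (lintegral_le_liminf_lintegral_of_forall_isOpen_measure_le_liminf_measure
      (μs := fun i => (μs i : Measure ℝ)) (f := fun x : ℝ => x ^ (2 * n)) (by fun_prop)
      (fun x => Even.pow_nonneg (even_two_mul n) _)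
      (fun G hG => ProbabilityMeasure.le_liminf_measure_open_of_tendsto hlim hG)).trans ?_
    have hi : ∀ i, ∫⁻ x, ENNReal.ofReal (x ^ (2 * n)) ∂(μs i : Measure ℝ) =
        ENNReal.ofReal (As i (Polynomial.X ^ (2 * n))) := by
      intro i
      rw [← (h i).2, ofReal_integral_eq_lintegral_ofReal ((h i).1 _)
        (Eventually.of_forall fun x => Even.pow_nonneg (even_two_mul n) _)]
    simp only [hi]
    exact ((ENNReal.continuous_ofReal.tendsto _).comp (hA (2 * n))).liminf_eq.le
  have heveni : ∀ n : ℕ, Integrable (fun x : ℝ => x ^ (2 * n)) (μ : Measure ℝ) := by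
    intro n
    refine ⟨by fun_prop, ?_⟩
    rw [hasFiniteIntegral_iff_ofReal
      (Eventually.of_forall fun x => Even.pow_nonneg (even_two_mul n) _)]
    exact (heven n).trans_lt ENNReal.ofReal_lt_top
  have hint : ∀ n : ℕ, Integrable (fun x : ℝ => x ^ n) (μ : Measure ℝ) := by
    intro n
    refine ((integrable_const 1).add (heveni n)).mono' (by fun_prop)
      (Eventually.of_forall fun x => ?_)
    simp only [Pi.add_apply]
    rw [Real.norm_eq_abs, mul_comm, pow_mul, ← sq_abs]
    nlinarith [sq_nonneg (|x ^ n| - 1)]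
  refine ⟨hint, fun n => ?_⟩
  set M := A (Polynomial.X ^ (2 * n)) with hM
  have hM0 : 0 ≤ M := ge_of_tendsto' (hA (2 * n)) fun i => by
    rw [← (h i).2]
    exact integral_nonneg fun x => Even.pow_nonneg (even_two_mul n) _
  have hevenle : ∫ x, x ^ (2 * n) ∂(μ : Measure ℝ) ≤ M := by
    have := heven n
    rwa [← ofReal_integral_eq_lintegral_ofReal (heveni n)
      (Eventually.of_forall fun x => Even.pow_nonneg (even_two_mul n) _),
      ENNReal.ofReal_le_ofReal_iff hM0] at this
  -- Truncate y = xⁿ at height K: where |y| > K, the error |y| − K is at most y²/K.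
  have trunc : ∀ K : ℝ, 0 < K → ∃ f : BoundedContinuousFunction ℝ ℝ, ∀ x : ℝ,
      |x ^ n - f x| ≤ x ^ (2 * n) / K := by
    intro K hK
    refine ⟨BoundedContinuousFunction.ofNormedAddCommGroup
      (fun x : ℝ => max (-K) (min K (x ^ n))) (by fun_prop) K fun x => ?_, fun x => ?_⟩
    · rw [Real.norm_eq_abs, abs_le]
      exact ⟨le_max_left _ _, max_le (by linarith) (min_le_left _ _)⟩
    · simp only [BoundedContinuousFunction.coe_ofNormedAddCommGroup]
      rw [le_div_iff₀ hK, mul_comm 2 n, pow_mul]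
      generalize x ^ n = y
      rcases le_total K y with h1 | h1
      · rw [min_eq_left h1, max_eq_right (by linarith), abs_of_nonneg (by linarith)]
        nlinarith
      · rw [min_eq_right h1]
        rcases le_total (-K) y with h2 | h2
        · rw [max_eq_right h2]
          simp only [sub_self, abs_zero, zero_mul]
          positivity
        · rw [max_eq_left h2, abs_of_nonpos (by linarith)]
          nlinarith
  have hclose : ∀ (ρ : ProbabilityMeasure ℝ) (f : BoundedContinuousFunction ℝ ℝ) (K : ℝ),
      (∀ m : ℕ, Integrable (fun x : ℝ => x ^ m) (ρ : Measure ℝ)) →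
      (∀ x : ℝ, |x ^ n - f x| ≤ x ^ (2 * n) / K) →
      |∫ x, x ^ n ∂(ρ : Measure ℝ) - ∫ x, f x ∂(ρ : Measure ℝ)| ≤
        (∫ x, x ^ (2 * n) ∂(ρ : Measure ℝ)) / K := by
    intro ρ f K hρ hf
    rw [← integral_sub (hρ n) (f.integrable _), ← integral_div]
    exact (abs_integral_le_integral_abs).trans (integral_mono
      ((hρ n).sub (f.integrable _)).abs ((hρ _).div_const _) hf)
  have hbound : ∀ K : ℝ, 0 < K →
      |∫ x, x ^ n ∂(μ : Measure ℝ) - A (Polynomial.X ^ n)| ≤ 2 * M / K := by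
    intro K hK
    obtain ⟨f, hf⟩ := trunc K hK
    have h1 := hclose μ f K hint hf
    have h2 : |A (Polynomial.X ^ n) - ∫ x, f x ∂(μ : Measure ℝ)| ≤ M / K := by
      have hf' := ProbabilityMeasure.tendsto_iff_forall_integral_tendsto.1 hlim f
      refine le_of_tendsto_of_tendsto' (((hA n).sub hf').abs) ((hA (2 * n)).div_const K) fun i => ?_
      have := hclose (μs i) f K (h i).1 hf
      rwa [(h i).2, (h i).2] at this
    have h3 : (∫ x, x ^ (2 * n) ∂(μ : Measure ℝ)) / K ≤ M / K := by gcongr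
    rw [abs_sub_comm] at h2
    calc _ ≤ |∫ x, x ^ n ∂(μ : Measure ℝ) - ∫ x, f x ∂(μ : Measure ℝ)| +
          |∫ x, f x ∂(μ : Measure ℝ) - A (Polynomial.X ^ n)| := abs_sub_le _ _ _
      _ ≤ 2 * M / K := by
        rw [two_mul, add_div]
        linarith
  have hlim0 : Tendsto (fun K : ℝ => 2 * M / K) atTop (𝓝 0) :=
    tendsto_const_nhds.div_atTop tendsto_id
  have := ge_of_tendsto hlim0 ((eventually_gt_atTop 0).mono hbound)
  exact sub_eq_zero.1 (abs_nonpos_iff.1 this)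

/-! ### Meixner families: semigroup property and admissibility -/

theorem hasMeixnerJacobiParameters_iff {T : Set ℝ} {μ : ℝ → ProbabilityMeasure ℝ}
    {β₀ γ₀ b c : ℝ} : HasMeixnerJacobiParameters T μ β₀ γ₀ b c ↔
      ∀ t ∈ T, HasMoments (μ t) (meixnerFunctional b c (β₀ * t) (γ₀ * t)) :=
  forall₂_congr fun _ _ => hasJacobiParameters_iff

theorem IsMeixner.hasMoments {μ : Measure ℝ} [IsProbabilityMeasure μ] {β₀ γ₀ b c : ℝ}
    (h : IsMeixner μ β₀ γ₀ b c) : HasMoments μ (meixnerFunctional b c β₀ γ₀) :=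
  hasJacobiParameters_iff.1 h.2

theorem HasMeixnerJacobiParameters.isConvolutionSemigroup {T : Set ℝ} (hT : IsTimeSet T)
    {μ : ℝ → ProbabilityMeasure ℝ} {β₀ γ₀ b c : ℝ}
    (h : HasMeixnerJacobiParameters T μ β₀ γ₀ b c) : IsConvolutionSemigroup T μ := by
  rw [hasMeixnerJacobiParameters_iff] at h
  intro s hs t ht
  have h1 := (h s hs).conv (h t ht)
  rw [functionalConv_meixnerFunctional, ← mul_add, ← mul_add] at h1
  obtain ⟨C, hC, hle⟩ := exists_abs_meixnerFunctional_le b c (β₀ * (s + t)) (γ₀ * (s + t))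
  exact (h (s + t) (hT.add_mem s hs t ht)).measure_eq h1 hC hle

theorem HasMeixnerJacobiParameters.hasPolynomialJacobiParameters {T : Set ℝ}
    {μ : ℝ → ProbabilityMeasure ℝ} {β₀ γ₀ b c : ℝ}
    (h : HasMeixnerJacobiParameters T μ β₀ γ₀ b c) : HasPolynomialJacobiParameters T μ := by
  refine ⟨fun n => Polynomial.C ((n : ℝ) * b) + Polynomial.C β₀ * Polynomial.X,
    fun n => Polynomial.C ((n : ℝ) + 1) *
      (Polynomial.C ((n : ℝ) * c) + Polynomial.C γ₀ * Polynomial.X), fun t ht => ?_⟩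
  simpa only [Polynomial.eval_add, Polynomial.eval_mul, Polynomial.eval_C, Polynomial.eval_X]
    using h t ht

/-- At the first k = N with kc + γ ≤ 0 all earlier factors are positive, so nonnegativity of the
next product forces Nc + γ = 0. -/
theorem exists_nat_eq_of_prod_nonneg {γ c : ℝ} (hγ : 0 < γ) (hc : c < 0)
    (h : ∀ n, 0 ≤ ∏ k ∈ Finset.range n, (((k : ℕ) : ℝ) + 1) * ((k : ℝ) * c + γ)) :
    ∃ N : ℕ, 1 ≤ N ∧ c = -γ / (N : ℝ) := by
  have hex : ∃ k : ℕ, (k : ℝ) * c + γ ≤ 0 := by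
    obtain ⟨k, hk⟩ := exists_nat_ge (γ / -c)
    rw [div_le_iff₀ (by linarith)] at hk
    exact ⟨k, by linarith⟩
  classical
  set N := Nat.find hex with hN
  have hNle : (N : ℝ) * c + γ ≤ 0 := Nat.find_spec hex
  have hlt : ∀ k < N, 0 < (k : ℝ) * c + γ := fun k hk => not_le.1 (Nat.find_min hex hk)
  have hpos : 0 < ∏ k ∈ Finset.range N, (((k : ℕ) : ℝ) + 1) * ((k : ℝ) * c + γ) :=
    Finset.prod_pos fun k hk => mul_pos (by positivity) (hlt k (Finset.mem_range.1 hk))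
  have hN0 : N ≠ 0 := by
    intro h0
    rw [h0] at hNle
    simp only [Nat.cast_zero, zero_mul, zero_add] at hNle
    linarith
  have h1 := h (N + 1)
  rw [Finset.prod_range_succ, mul_nonneg_iff_of_pos_left hpos,
    mul_nonneg_iff_of_pos_left (by positivity)] at h1
  have hNpos : (0 : ℝ) < N := by exact_mod_cast Nat.pos_of_ne_zero hN0
  refine ⟨N, Nat.pos_of_ne_zero hN0, ?_⟩
  rw [eq_div_iff hNpos.ne']
  linarith

theorem meixnerAdmissible_of_hasMoments {μ : Measure ℝ} {β γ b c : ℝ} (hγ : 0 < γ)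
    (h : HasMoments μ (meixnerFunctional b c β γ)) : MeixnerAdmissible γ c := by
  refine ⟨hγ.le, or_iff_not_imp_left.2 fun hc => ?_⟩
  exact exists_nat_eq_of_prod_nonneg hγ (not_le.1 hc) h.prod_nonneg

theorem nonneg_of_hasMeixnerJacobiParameters_Ici {μ : ℝ → ProbabilityMeasure ℝ} {β₀ γ₀ b c : ℝ}
    (hadm : MeixnerAdmissible γ₀ c)
    (h : HasMeixnerJacobiParameters (Set.Ici 0) μ β₀ γ₀ b c) : 0 ≤ c := by
  by_contra hc
  rw [not_le] at hc
  have hγ : 0 < γ₀ := by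
    refine lt_of_le_of_ne hadm.1 fun h0 => ?_
    rcases hadm.2 with h1 | ⟨N, -, h1⟩
    · linarith
    · rw [← h0] at h1
      simp at h1
      linarith
  -- At this time γ₀t = −c/2, so the required integer N would be 1/2.
  have ht : 0 < -c / (2 * γ₀) := div_pos (by linarith) (by linarith)
  have hm := hasMeixnerJacobiParameters_iff.1 h (-c / (2 * γ₀)) ht.le
  obtain ⟨N, hN, hcN⟩ := exists_nat_eq_of_prod_nonneg (mul_pos hγ ht) hc hm.prod_nonneg
  have hN' : (1 : ℝ) ≤ N := by exact_mod_cast hN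
  have : c * N = c / 2 := by
    rw [eq_div_iff (by linarith)] at hcN
    rw [hcN]
    field_simp
  nlinarith

/-! ### Rational times -/

theorem IsTimeSet.nat_mul_mem {T : Set ℝ} (hT : IsTimeSet T) {t : ℝ} (ht : t ∈ T) (n : ℕ) :
    ((n + 1 : ℕ) : ℝ) * t ∈ T := by
  induction n with
  | zero => simpa using ht
  | succ n ih =>
    rw [Nat.cast_succ, add_mul, one_mul]
    exact hT.add_mem _ ih _ ht

theorem IsConvolutionSemigroup.hasMoments_nat_mul {T : Set ℝ} (hT : IsTimeSet T)
    {μ : ℝ → ProbabilityMeasure ℝ} (hμ : IsConvolutionSemigroup T μ) {t : ℝ} (ht : t ∈ T)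
    {A : Polynomial ℝ →ₗ[ℝ] ℝ} (hA : HasMoments (μ t) A) (n : ℕ) :
    ∃ A', HasMoments (μ (((n + 1 : ℕ) : ℝ) * t)) A' ∧
      momentSeries A' = momentSeries A ^ (n + 1) := by
  induction n with
  | zero => exact ⟨A, by simpa using hA, by simp⟩
  | succ n ih =>
    obtain ⟨A', h1, h2⟩ := ih
    refine ⟨functionalConv A' A, ?_, by rw [momentSeries_functionalConv, h2, pow_succ _ (n + 1)]⟩
    rw [Nat.cast_succ (n + 1), add_mul, one_mul, hμ _ (hT.nat_mul_mem ht n) _ ht]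
    exact h1.conv hA

theorem IsConvolutionSemigroup.exists_hasMoments_of_add {T : Set ℝ}
    {μ : ℝ → ProbabilityMeasure ℝ} (hμ : IsConvolutionSemigroup T μ) {s t : ℝ} (hs : s ∈ T)
    (ht : t ∈ T) {A : Polynomial ℝ →ₗ[ℝ] ℝ} (hA : HasMoments (μ (s + t)) A) :
    ∃ A', HasMoments (μ t) A' := by
  have h := hA.1
  rw [hμ s hs t ht] at h
  exact exists_hasMoments (integrable_pow_of_conv h)

theorem exists_nat_mul_eq_of_rat {s : ℝ} (hs : 0 < s) {q : ℚ} (hq : (q : ℝ) = s) :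
    ∃ m n : ℕ, ((m + 1 : ℕ) : ℝ) * s = (n + 1 : ℕ) := by
  have hq0 : 0 < q := by
    rw [← hq] at hs
    exact_mod_cast hs
  have hnum : 0 < q.num := Rat.num_pos.2 hq0
  refine ⟨q.den - 1, q.num.toNat - 1, ?_⟩
  rw [Nat.sub_add_cancel q.den_pos, Nat.sub_add_cancel (by omega), ← hq]
  have h1 : (q.den : ℚ) * q = q.num := by rw [mul_comm]; exact Rat.mul_den_eq_num q
  have h2 : ((q.num.toNat : ℤ) : ℚ) = q.num := by rw [Int.toNat_of_nonneg hnum.le]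
  have h3 : (q.den : ℚ) * q = (q.num.toNat : ℕ) := by
    rw [h1, ← h2, Int.cast_natCast]
  exact_mod_cast h3

/-- The moments of a convolution semigroup at positive rational times are determined by
the moments at time `1`. -/
theorem IsConvolutionSemigroup.hasMoments_meixner_of_rat_pos {T : Set ℝ} (hT : IsTimeSet T)
    {μ : ℝ → ProbabilityMeasure ℝ} (hμ : IsConvolutionSemigroup T μ) {β₀ γ₀ b c : ℝ}
    (h1 : HasMoments (μ 1) (meixnerFunctional b c β₀ γ₀)) {s : ℝ} (hs : s ∈ T) (hs0 : 0 < s)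
    {q : ℚ} (hq : (q : ℝ) = s) :
    HasMoments (μ s) (meixnerFunctional b c (β₀ * s) (γ₀ * s)) := by
  obtain ⟨m, n, hmn⟩ := exists_nat_mul_eq_of_rat hs0 hq
  -- Both multiples in (m+1)s = n+1 are doubled: (2m+2)s then splits as (2m+1)s + s with both times
  -- in T even for m = 0, and moments of `μ s` become finite as those of a convolution factor.
  obtain ⟨A₁, hA₁, hA₁s⟩ := hμ.hasMoments_nat_mul hT hT.one_mem h1 (2 * n + 1)
  have hmn' : ((2 * m + 1 + 1 : ℕ) : ℝ) * s = ((2 * n + 1 + 1 : ℕ) : ℝ) * 1 := by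
    push_cast at hmn ⊢
    linarith
  rw [← hmn'] at hA₁
  obtain ⟨A, hA⟩ : ∃ A, HasMoments (μ s) A := by
    have h2 := hA₁
    rw [Nat.cast_succ, add_mul, one_mul] at h2
    exact hμ.exists_hasMoments_of_add (hT.nat_mul_mem hs (2 * m)) hs h2
  obtain ⟨A₂, hA₂, hA₂s⟩ := hμ.hasMoments_nat_mul hT hs hA (2 * m + 1)
  -- Both series have the same power of exponent 2m + 2, namely the series at time (2m+2)s = 2n + 2.
  have hAM : A = meixnerFunctional b c (β₀ * s) (γ₀ * s) := by
    refine momentSeries_injective (powerSeries_eq_of_pow_eq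
      (constantCoeff_momentSeries hA.map_one)
      (constantCoeff_momentSeries_meixnerFunctional _ _ _ _) (Nat.succ_ne_zero (2 * m + 1)) ?_)
    rw [Nat.succ_eq_add_one, ← hA₂s, hA₂.unique hA₁, hA₁s, ← momentSeries_meixnerFunctional_nat,
      ← momentSeries_meixnerFunctional_nat, mul_assoc β₀, mul_assoc γ₀, mul_comm s, hmn', mul_one]
  rwa [← hAM]

/-- Time 0 may belong to T, so the positive time 1 + t is used and the nonzero series at time 1 is
cancelled. -/
theorem IsConvolutionSemigroup.hasMoments_meixner_of_rat {T : Set ℝ} (hT : IsTimeSet T)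
    {μ : ℝ → ProbabilityMeasure ℝ} (hμ : IsConvolutionSemigroup T μ) {β₀ γ₀ b c : ℝ}
    (h1 : HasMoments (μ 1) (meixnerFunctional b c β₀ γ₀)) {t : ℝ} (ht : t ∈ T)
    {q : ℚ} (hq : (q : ℝ) = t) :
    HasMoments (μ t) (meixnerFunctional b c (β₀ * t) (γ₀ * t)) := by
  have h2 := hμ.hasMoments_meixner_of_rat_pos hT h1 (hT.add_mem 1 hT.one_mem t ht)
    (by linarith [hT.nonneg t ht]) (q := 1 + q) (by push_cast; rw [hq])
  obtain ⟨A, hA⟩ := hμ.exists_hasMoments_of_add hT.one_mem ht h2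
  have h3 := h1.conv hA
  rw [← hμ 1 hT.one_mem t ht] at h3
  have h4 := momentSeries_functionalConv (meixnerFunctional b c β₀ γ₀) A
  rw [← h2.unique h3, mul_add, mul_add, mul_one, mul_one,
    momentSeries_meixnerFunctional_add] at h4
  have hne : momentSeries (meixnerFunctional b c β₀ γ₀) ≠ 0 := by
    intro h0
    have := constantCoeff_momentSeries_meixnerFunctional b c β₀ γ₀
    rw [h0, map_zero] at this
    exact zero_ne_one this
  rwa [momentSeries_injective (mul_left_cancel₀ hne h4)]

theorem isTimeSet_Ici : IsTimeSet (Set.Ici 0) where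
  nonneg _ ht := ht
  one_mem := Set.mem_Ici.2 zero_le_one
  add_mem _ hs _ ht := add_nonneg (Set.mem_Ici.1 hs) (Set.mem_Ici.1 ht)

/-! ### Real times by weak continuity -/

open Filter Topology in
theorem hasMeixnerJacobiParameters_of_continuousOn {μ : ℝ → ProbabilityMeasure ℝ}
    (hμ : IsConvolutionSemigroup (Set.Ici 0) μ) (hcont : ContinuousOn μ (Set.Ici 0))
    {β₀ γ₀ b c : ℝ} (h1 : HasMoments (μ 1) (meixnerFunctional b c β₀ γ₀)) :
    HasMeixnerJacobiParameters (Set.Ici 0) μ β₀ γ₀ b c := by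
  rw [hasMeixnerJacobiParameters_iff]
  intro t ht
  -- Approximation from above keeps the rational times in [0, ∞), also for t = 0.
  obtain ⟨u, -, hu, hlim⟩ := Real.exists_seq_rat_strictAnti_tendsto t
  have hmem : ∀ i, (u i : ℝ) ∈ Set.Ici (0 : ℝ) := fun i => (Set.mem_Ici.1 ht).trans (hu i).le
  refine hasMoments_of_tendsto (μs := fun i => μ (u i))
    ((hcont t ht).tendsto.comp (tendsto_nhdsWithin_iff.2 ⟨hlim, Eventually.of_forall hmem⟩))
    (fun i => hμ.hasMoments_meixner_of_rat isTimeSet_Ici h1 (hmem i) rfl) fun n => ?_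
  exact ((continuous_meixnerFunctional_X_pow b c β₀ γ₀ n).tendsto t).comp hlim

/-! ### Rigidity of polynomial Jacobi parameters -/

/-- The polynomial in `t` whose values are the parameters `n b + β₀ t`. -/
noncomputable def meixnerDiagonal (b β₀ : ℝ) (n : ℕ) : Polynomial ℝ :=
  Polynomial.C ((n : ℝ) * b) + Polynomial.C β₀ * Polynomial.X

/-- The polynomial in `t` whose values are the parameters `(n + 1) (n c + γ₀ t)`. -/
noncomputable def meixnerOffDiagonal (c γ₀ : ℝ) (n : ℕ) : Polynomial ℝ :=
  Polynomial.C ((n : ℝ) + 1) * (Polynomial.C ((n : ℝ) * c) + Polynomial.C γ₀ * Polynomial.X)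

theorem eval_meixnerDiagonal (b β₀ t : ℝ) (n : ℕ) :
    (meixnerDiagonal b β₀ n).eval t = n * b + β₀ * t := by
  simp [meixnerDiagonal]

theorem eval_meixnerOffDiagonal (c γ₀ t : ℝ) (n : ℕ) :
    (meixnerOffDiagonal c γ₀ n).eval t = (n + 1) * (n * c + γ₀ * t) := by
  simp [meixnerOffDiagonal]

theorem natDegree_meixnerOffDiagonal {c γ₀ : ℝ} (hγ : γ₀ ≠ 0) (n : ℕ) :
    (meixnerOffDiagonal c γ₀ n).natDegree = 1 := by
  rw [meixnerOffDiagonal, Polynomial.natDegree_C_mul (by positivity), add_comm,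
    Polynomial.natDegree_linear hγ]

/-- Linearity at all positive integers makes the polynomial a multiple of X, while the product has
degree exactly n. For n ≥ 2 no nonzero D fits; for n < 2 the value at 1 makes the multiple zero. -/
theorem eq_zero_of_prod_mul_eval_linear {c γ₀ : ℝ} {n : ℕ} (hγ : γ₀ ≠ 0 ∨ n = 0)
    {D : Polynomial ℝ}
    (h : ∀ m : ℕ, ((∏ k ∈ Finset.range n, meixnerOffDiagonal c γ₀ k) * D).eval ((m + 1 : ℕ) : ℝ) =
      ((m + 1 : ℕ) : ℝ) * ((∏ k ∈ Finset.range n, meixnerOffDiagonal c γ₀ k) * D).eval 1)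
    (hD : n < 2 → D.eval 1 = 0) : D = 0 := by
  set Q := ∏ k ∈ Finset.range n, meixnerOffDiagonal c γ₀ k with hQ
  have hne : ∀ k ∈ Finset.range n, meixnerOffDiagonal c γ₀ k ≠ 0 := by
    intro k hk h0
    rw [Finset.mem_range] at hk
    have := natDegree_meixnerOffDiagonal (c := c) (hγ.resolve_right (by omega)) k
    simp [h0] at this
  have hQ0 : Q ≠ 0 := Finset.prod_ne_zero_iff.2 hne
  have hQd : Q.natDegree = n := by
    rw [hQ, Polynomial.natDegree_prod _ _ hne]
    rw [Finset.sum_congr rfl fun k hk => natDegree_meixnerOffDiagonal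
      (hγ.resolve_right (by have := Finset.mem_range.1 hk; omega)) k]
    simp
  have heq : Q * D = Polynomial.C ((Q * D).eval 1) * Polynomial.X := by
    refine Polynomial.eq_of_infinite_eval_eq _ _ (Set.Infinite.mono
      (s := Set.range fun m : ℕ => ((m + 1 : ℕ) : ℝ)) ?_ (Set.infinite_range_of_injective ?_))
    · rintro _ ⟨m, rfl⟩
      rw [Set.mem_ofPred_eq, h m, Polynomial.eval_C_mul, Polynomial.eval_X, mul_comm]
    · intro m m' hmm
      simpa using hmm
  rcases Nat.lt_or_ge n 2 with hn | hn
  · rw [Polynomial.eval_mul, hD hn, mul_zero, map_zero, zero_mul] at heq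
    exact (mul_eq_zero.1 heq).resolve_left hQ0
  · by_contra hD0
    have hd := Polynomial.natDegree_mul hQ0 hD0
    have hle := (Polynomial.natDegree_C_mul_le ((Q * D).eval 1) Polynomial.X).trans
      Polynomial.natDegree_X_le
    rw [← heq, hd, hQd] at hle
    omega

/-- If two families of functionals have the same behaviour under convolution and agree up to
degree `N` at time `1`, then the difference in degree `N` is additive in time. -/
theorem sub_X_pow_eq_nat_mul {A A' M M' : Polynomial ℝ →ₗ[ℝ] ℝ} {n : ℕ}
    (hA : momentSeries A' = momentSeries A ^ n) (hM : momentSeries M' = momentSeries M ^ n)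
    (hA1 : A 1 = 1) {N : ℕ} (hN : N ≠ 0)
    (h : ∀ k < N, A (Polynomial.X ^ k) = M (Polynomial.X ^ k)) :
    A' (Polynomial.X ^ N) - M' (Polynomial.X ^ N) =
      n * (A (Polynomial.X ^ N) - M (Polynomial.X ^ N)) := by
  have key := (powerSeries_coeff_pow_sub (f := momentSeries A) (g := momentSeries M) hN
    (fun k hk => by simp only [momentSeries, PowerSeries.coeff_mk, h k hk])
    (constantCoeff_momentSeries hA1) n).2
  rw [← hA, ← hM] at key
  simp only [momentSeries, PowerSeries.coeff_mk] at key
  field_simp at key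
  linarith

/-- A functional semigroup with polynomial Jacobi parameters that agrees with Meixner parameters
below index `n` agrees with them at `n`, if the first four parameters are adjusted at time `1`. -/
theorem jacobi_eq_meixner_step {B G : ℕ → Polynomial ℝ} {β₀ γ₀ b c : ℝ}
    (hS : ∀ m : ℕ, momentSeries (jacobiFunctional (fun k => (B k).eval ((m + 1 : ℕ) : ℝ))
        (fun k => (G k).eval ((m + 1 : ℕ) : ℝ))) =
      momentSeries (jacobiFunctional (fun k => (B k).eval 1) (fun k => (G k).eval 1)) ^ (m + 1))
    (hB : ∀ k < 2, (B k).eval 1 = (meixnerDiagonal b β₀ k).eval 1)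
    (hG : ∀ k < 2, (G k).eval 1 = (meixnerOffDiagonal c γ₀ k).eval 1)
    {n : ℕ} (hγ : γ₀ ≠ 0 ∨ n = 0) (hBn : ∀ k < n, B k = meixnerDiagonal b β₀ k)
    (hGn : ∀ k < n, G k = meixnerOffDiagonal c γ₀ k) :
    B n = meixnerDiagonal b β₀ n ∧ G n = meixnerOffDiagonal c γ₀ n := by
  set J : ℝ → Polynomial ℝ →ₗ[ℝ] ℝ := fun t =>
    jacobiFunctional (fun k => (B k).eval t) (fun k => (G k).eval t) with hJ
  set M : ℝ → Polynomial ℝ →ₗ[ℝ] ℝ := fun t => jacobiFunctional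
    (fun k => (meixnerDiagonal b β₀ k).eval t) (fun k => (meixnerOffDiagonal c γ₀ k).eval t) with hM
  have hMt : ∀ t, M t = meixnerFunctional b c (β₀ * t) (γ₀ * t) := by
    intro t
    simp only [hM, eval_meixnerDiagonal, eval_meixnerOffDiagonal, meixnerFunctional]
  have hMS : ∀ m : ℕ, momentSeries (M ((m + 1 : ℕ) : ℝ)) = momentSeries (M 1) ^ (m + 1) := by
    intro m
    rw [hMt, hMt, momentSeries_meixnerFunctional_nat, mul_one, mul_one]
  have h0 : ∀ t, ∀ k ≤ 2 * n, J t (Polynomial.X ^ k) = M t (Polynomial.X ^ k) := fun t =>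
    jacobiFunctional_X_pow_congr n (fun k hk => by rw [hBn k hk]) (fun k hk => by rw [hGn k hk])
  -- The deviation of the moment is a polynomial in t, evaluated at the same t for both families;
  -- this is where polynomial dependence on time enters.
  have hodd : ∀ t, J t (Polynomial.X ^ (2 * n + 1)) - M t (Polynomial.X ^ (2 * n + 1)) =
      ((∏ k ∈ Finset.range n, meixnerOffDiagonal c γ₀ k) *
        (B n - meixnerDiagonal b β₀ n)).eval t := by
    intro t
    rw [Polynomial.eval_mul, Polynomial.eval_prod, Polynomial.eval_sub]
    exact jacobiFunctional_sub_odd n (fun k hk => by rw [hBn k hk]) (fun k hk => by rw [hGn k hk])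
      (h0 t)
  have hBn' : B n = meixnerDiagonal b β₀ n := by
    refine sub_eq_zero.1 (eq_zero_of_prod_mul_eval_linear (c := c) hγ (fun m => ?_) fun hn => ?_)
    · rw [← hodd, ← hodd]
      exact sub_X_pow_eq_nat_mul (hS m) (hMS m) (jacobiFunctional_one _ _) (Nat.succ_ne_zero _)
        fun k hk => h0 1 k (by omega)
    · rw [Polynomial.eval_sub, hB n hn, sub_self]
  have h1 : ∀ t, ∀ k ≤ 2 * n + 1, J t (Polynomial.X ^ k) = M t (Polynomial.X ^ k) := by
    intro t k hk
    rcases Nat.lt_or_ge (2 * n) k with hk' | hk'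
    · obtain rfl : k = 2 * n + 1 := by omega
      have := hodd t
      rw [hBn', sub_self, mul_zero, Polynomial.eval_zero] at this
      exact sub_eq_zero.1 this
    · exact h0 t k hk'
  have heven : ∀ t, J t (Polynomial.X ^ (2 * n + 2)) - M t (Polynomial.X ^ (2 * n + 2)) =
      ((∏ k ∈ Finset.range n, meixnerOffDiagonal c γ₀ k) *
        (G n - meixnerOffDiagonal c γ₀ n)).eval t := by
    intro t
    rw [Polynomial.eval_mul, Polynomial.eval_prod, Polynomial.eval_sub]
    refine jacobiFunctional_sub_even n (fun k hk => ?_) (fun k hk => by rw [hGn k hk]) (h1 t)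
    rcases hk.lt_or_eq with hk | rfl
    · rw [hBn k hk]
    · rw [hBn']
  refine ⟨hBn', sub_eq_zero.1 (eq_zero_of_prod_mul_eval_linear (c := c) hγ (fun m => ?_)
    fun hn => ?_)⟩
  · rw [← heven, ← heven]
    exact sub_X_pow_eq_nat_mul (hS m) (hMS m) (jacobiFunctional_one _ _) (Nat.succ_ne_zero _)
      fun k hk => h1 1 k (by omega)
  · rw [Polynomial.eval_sub, hG n hn, sub_self]

theorem IsConvolutionSemigroup.exists_meixner {T : Set ℝ} (hT : IsTimeSet T)
    {μ : ℝ → ProbabilityMeasure ℝ} (hμ : IsConvolutionSemigroup T μ)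
    (hp : HasPolynomialJacobiParameters T μ) :
    ∃ β₀ γ₀ b c : ℝ, MeixnerAdmissible γ₀ c ∧ HasMeixnerJacobiParameters T μ β₀ γ₀ b c := by
  obtain ⟨B, G, hBG⟩ := hp
  have hJ : ∀ t ∈ T, HasMoments (μ t)
      (jacobiFunctional (fun k => (B k).eval t) (fun k => (G k).eval t)) :=
    fun t ht => hasJacobiParameters_iff.1 (hBG t ht)
  have hS : ∀ m : ℕ, momentSeries (jacobiFunctional (fun k => (B k).eval ((m + 1 : ℕ) : ℝ))
        (fun k => (G k).eval ((m + 1 : ℕ) : ℝ))) =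
      momentSeries (jacobiFunctional (fun k => (B k).eval 1) (fun k => (G k).eval 1)) ^
        (m + 1) := by
    intro m
    obtain ⟨A, hA, hAs⟩ := hμ.hasMoments_nat_mul hT hT.one_mem (hJ 1 hT.one_mem) m
    rw [← hAs]
    have := hJ _ (hT.nat_mul_mem hT.one_mem m)
    rw [hA.unique this, mul_one]
  have hγ0 : 0 ≤ (G 0).eval 1 := by simpa using (hJ 1 hT.one_mem).prod_nonneg 1
  set β₀ := (B 0).eval 1 with hβ₀
  set γ₀ := (G 0).eval 1 with hγ₀
  set b := (B 1).eval 1 - β₀ with hb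
  -- This solves 2(c + γ₀) = G₁(1), the case n = 1 of the formula for γₙ.
  set c := (G 1).eval 1 / 2 - γ₀ with hc
  have hB : ∀ k < 2, (B k).eval 1 = (meixnerDiagonal b β₀ k).eval 1 := by
    intro k hk
    rw [eval_meixnerDiagonal]
    interval_cases k
    · simp [hβ₀]
    · simp [hb]
  have hG : ∀ k < 2, (G k).eval 1 = (meixnerOffDiagonal c γ₀ k).eval 1 := by
    intro k hk
    rw [eval_meixnerOffDiagonal]
    interval_cases k
    · simp [hγ₀]
    · rw [hc]
      push_cast
      ring
  -- If γ₀ = 0, index 0 already gives G₀ = 0 and B₀ = β₀X; both functionals are then evaluation at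
  -- β₀t whatever the later parameters, so b = c = 0 may be chosen.
  rcases hγ0.eq_or_lt with h0 | hpos
  · refine ⟨β₀, γ₀, 0, 0, ⟨hγ0, Or.inl le_rfl⟩, hasMeixnerJacobiParameters_iff.2 fun t ht => ?_⟩
    obtain ⟨hB0, hG0⟩ := jacobi_eq_meixner_step hS hB hG (n := 0) (Or.inr rfl)
      (fun k hk => by omega) (fun k hk => by omega)
    convert hJ t ht using 1
    refine LinearMap.ext fun p => ?_
    rw [meixnerFunctional, jacobiFunctional_eq_eval (by simp [← h0]), jacobiFunctional_eq_eval]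
    · simp [hB0, eval_meixnerDiagonal]
    · simp [hG0, eval_meixnerOffDiagonal, ← h0]
  · have key : ∀ n, B n = meixnerDiagonal b β₀ n ∧ G n = meixnerOffDiagonal c γ₀ n := by
      intro n
      induction n using Nat.strong_induction_on with
      | _ n ih =>
        exact jacobi_eq_meixner_step hS hB hG (Or.inl hpos.ne') (fun k hk => (ih k hk).1)
          (fun k hk => (ih k hk).2)
    have hm : ∀ t ∈ T, HasMoments (μ t) (meixnerFunctional b c (β₀ * t) (γ₀ * t)) := by
      intro t ht
      have := hJ t ht
      simp only [fun n => (key n).1, fun n => (key n).2, eval_meixnerDiagonal,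
        eval_meixnerOffDiagonal] at this
      exact this
    refine ⟨β₀, γ₀, b, c, ?_, hasMeixnerJacobiParameters_iff.2 hm⟩
    have := hm 1 hT.one_mem
    rw [mul_one, mul_one] at this
    exact meixnerAdmissible_of_hasMoments hpos this

theorem mainTheorem3 :
    (∀ (T : Set ℝ) (_ : IsTimeSet T) (μ : ℝ → ProbabilityMeasure ℝ),
      (IsConvolutionSemigroup T μ ∧ HasPolynomialJacobiParameters T μ) ↔
        ∃ β₀ γ₀ b c : ℝ, MeixnerAdmissible γ₀ c ∧ (T = Set.Ici 0 → 0 ≤ c) ∧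
          HasMeixnerJacobiParameters T μ β₀ γ₀ b c) ∧
    (∀ (T : Set ℝ) (_ : IsTimeSet T) (_ : ∀ t ∈ T, ∃ q : ℚ, (q : ℝ) = t)
      (μ : ℝ → ProbabilityMeasure ℝ) (_ : IsConvolutionSemigroup T μ)
      (β₀ γ₀ b c : ℝ) (_ : IsMeixner (μ 1) β₀ γ₀ b c),
        HasMeixnerJacobiParameters T μ β₀ γ₀ b c) ∧
    (∀ (μ : ℝ → ProbabilityMeasure ℝ) (_ : IsConvolutionSemigroup (Set.Ici 0) μ)
      (_ : ContinuousOn μ (Set.Ici 0))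
      (β₀ γ₀ b c : ℝ) (_ : IsMeixner (μ 1) β₀ γ₀ b c),
        0 ≤ c ∧ HasMeixnerJacobiParameters (Set.Ici 0) μ β₀ γ₀ b c) := by
  refine ⟨fun T hT μ => ⟨?_, ?_⟩, fun T hT hrat μ hμ β₀ γ₀ b c h1 => ?_,
    fun μ hμ hcont β₀ γ₀ b c h1 => ?_⟩
  · rintro ⟨hμ, hp⟩
    obtain ⟨β₀, γ₀, b, c, hadm, h⟩ := hμ.exists_meixner hT hp
    refine ⟨β₀, γ₀, b, c, hadm, ?_, h⟩
    rintro rfl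
    exact nonneg_of_hasMeixnerJacobiParameters_Ici hadm h
  · rintro ⟨β₀, γ₀, b, c, -, -, h⟩
    exact ⟨h.isConvolutionSemigroup hT, h.hasPolynomialJacobiParameters⟩
  · rw [hasMeixnerJacobiParameters_iff]
    intro t ht
    obtain ⟨q, hq⟩ := hrat t ht
    exact hμ.hasMoments_meixner_of_rat hT h1.hasMoments ht hq
  · have h := hasMeixnerJacobiParameters_of_continuousOn hμ hcont h1.hasMoments
    exact ⟨nonneg_of_hasMeixnerJacobiParameters_Ici h1.1 h, h⟩
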